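/- Let $V$ be a finite-dimensional real vector space with a symmetric bilinear form $B$, and let $\Delta$ be a basis of $V$ such that $B(\alpha,\alpha)=1$ for all $\alpha\in\Delta$ and $B(\alpha,\beta)\in(-\infty,-1]\cup\{-\cos(\pi/k) : k\in\mathbb Z_{\ge 2}\}$ for all distinct $\alpha,\beta\in\Delta$. Let $W$ be the group generated by the reflections $s_\alpha(v)=v-2B(\alpha,v)\,\alpha$ for $\alpha\in\Delta$, let $\Phi=W(\Delta)$ be the associated root system, and let $\Phi^+$ be the set of roots that are linear combinations of elements of $\Delta$ with nonnegative coefficients. Assume that $\Phi$ is infinite. For $v\in V$ let $|v|_1$ be the sum of the coordinates of $v$ in the basis $\Delta$, put $V_1=\{v : |v|_1=1\}$, and write $\widehat v=v/|v|_1$ when $|v|_1\neq 0$ (which holds for every root). Let $\widehat Q=\{v\in V_1 : B(v,v)=0\}$, let $\widehat\Phi=\{\widehat\rho : \rho\in\Phi\}$ be the set of normalized roots, and let $E$ be the set of limit roots, i.e. of accumulation points of $\widehat\Phi$. For distinct points $x,y$ let $L(x,y)$ denote the affine line through $x$ and $y$, and put $$E_2^\circ=\bigcup_{\alpha\in\Delta,\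 \rho\in\Phi^+,\ \rho\ne\alpha} L(\alpha,\widehat\rho)\cap\widehat Q .$$ Then $E_2^\circ\subseteq E$, and $E_2^\circ$ is dense in $E$, that is, $E\subseteq\overline{E_2^\circ}$. -/

import Mathlib

open Set Topology

namespace BasedRoot

section Algebra

variable {V : Type*} [AddCommGroup V] [Module ℝ V]

/-- A simple system in `(V, B)`: a finite, positively independent set of vectors of `B`-square `1`
whose mutual products lie in `(-∞, -1] ∪ {-cos (π / k) | k ≥ 2}`. -/
structure IsSimpleSystem (B : LinearMap.BilinForm ℝ V) (Δ : Set V) : Prop where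
  finite : Δ.Finite
  posIndep : ∀ c : V →₀ ℝ, (c.support : Set V) ⊆ Δ → (∀ α, 0 ≤ c α) →
    (c.sum fun α t => t • α) = 0 → c = 0
  offDiag : ∀ α ∈ Δ, ∀ β ∈ Δ, α ≠ β →
    B α β ≤ -1 ∨ ∃ k : ℕ, 2 ≤ k ∧ B α β = -Real.cos (Real.pi / k)
  diag : ∀ α ∈ Δ, B α α = 1

/-- The linear map `v ↦ v - 2 (B(α, v) / B(α, α)) α`. -/
noncomputable def reflectionMap (B : LinearMap.BilinForm ℝ V) (α : V) : V →ₗ[ℝ] V :=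
  LinearMap.id - (2 * (B α α)⁻¹) • (B α).smulRight α

theorem reflectionMap_apply (B : LinearMap.BilinForm ℝ V) (α v : V) :
    reflectionMap B α v = v - (2 * (B α v / B α α)) • α := by
  simp only [reflectionMap, LinearMap.sub_apply, LinearMap.id_apply, LinearMap.smul_apply,
    LinearMap.smulRight_apply, smul_smul]
  congr 2
  ring

theorem reflectionMap_involutive (B : LinearMap.BilinForm ℝ V) (α : V) (h : B α α ≠ 0) :
    Function.Involutive (reflectionMap B α) := by
  intro v
  have h2 : 2 * (B α α / B α α) = 2 := by rw [div_self h, mul_one]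
  simp only [reflectionMap_apply, map_sub, map_smul, h2]
  module

/-- The `B`-reflection `s_α`, for `B(α, α) ≠ 0`. -/
noncomputable def reflection (B : LinearMap.BilinForm ℝ V) (α : V) (h : B α α ≠ 0) : V ≃ₗ[ℝ] V :=
  LinearEquiv.ofInvolutive (reflectionMap B α) (reflectionMap_involutive B α h)

/-- The group `W` generated by the `B`-reflections in the elements of `Δ`. -/
def weylGroup (B : LinearMap.BilinForm ℝ V) (Δ : Set V) : Subgroup (V ≃ₗ[ℝ] V) :=
  Subgroup.closure {g | ∃ α ∈ Δ, ∃ h : B α α ≠ 0, g = reflection B α h}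

/-- The root system `Φ`, the orbit of `Δ` under `W`. -/
def roots (B : LinearMap.BilinForm ℝ V) (Δ : Set V) : Set V :=
  {ρ | ∃ w ∈ weylGroup B Δ, ∃ α ∈ Δ, ρ = w α}

/-- The positive roots `Φ⁺ = Φ ∩ cone(Δ)`. -/
def posRoots (B : LinearMap.BilinForm ℝ V) (Δ : Set V) : Set V :=
  roots B Δ ∩ (PointedCone.hull ℝ Δ : Set V)

/-- The isotropic cone `Q`. -/
def isotropicCone (B : LinearMap.BilinForm ℝ V) : Set V := {v | B v v = 0}

variable {ι : Type*} [Fintype ι]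

/-- The sum `|v|₁` of the coordinates of `v` in the basis of simple roots. -/
noncomputable def coordSum (b : Module.Basis ι ℝ V) (v : V) : ℝ := ∑ i, b.repr v i

/-- The affine hyperplane `V₁`. -/
def affHyperplane (b : Module.Basis ι ℝ V) : Set V := {v | coordSum b v = 1}

/-- The normalization `v̂ = v / |v|₁` (meaningful when `|v|₁ ≠ 0`). -/
noncomputable def normalize (b : Module.Basis ι ℝ V) (v : V) : V := (coordSum b v)⁻¹ • v

/-- The normalized isotropic cone `Q̂ = Q ∩ V₁`. -/
def normIsotropicCone (B : LinearMap.BilinForm ℝ V) (b : Module.Basis ι ℝ V) : Set V :=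
  isotropicCone B ∩ affHyperplane b

/-- The normalized roots `Φ̂`. -/
def normRoots (B : LinearMap.BilinForm ℝ V) (b : Module.Basis ι ℝ V) : Set V :=
  normalize b '' roots B (range b)

/-- The set `E₂°`: the points of `Q̂` on a line `L(α, ρ̂)` through a simple root `α` and a
normalized positive root `ρ̂`. For `ρ = α` the affine span is the point `α`, which is not
isotropic, so this degenerate case contributes nothing. -/
def simpleDihedralLimitRoots (B : LinearMap.BilinForm ℝ V) (b : Module.Basis ι ℝ V) : Set V :=
  ⋃ α ∈ range b, ⋃ ρ ∈ posRoots B (range b),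
    (affineSpan ℝ {α, normalize b ρ} : Set V) ∩ normIsotropicCone B b

end Algebra

section Topology

variable {V : Type*} [NormedAddCommGroup V] [NormedSpace ℝ V] {ι : Type*} [Fintype ι]

/-- The set `E` of limit roots: the accumulation points of the normalized roots. -/
def limitRoots (B : LinearMap.BilinForm ℝ V) (b : Module.Basis ι ℝ V) : Set V :=
  derivedSet (normRoots B b)

end Topology

end BasedRoot

/-! Normalized positive roots can only accumulate at isotropic vectors: by discreteness of the root
system the coordinate sums of distinct positive roots tend to infinity, while `B (ρ, ρ) = 1`. Along
a dihedral subgroup generated by `s_α` and `s_ρ` with `B (α, ρ) ≤ -1` the roots are explicit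
Chebyshev combinations of `α` and `ρ`, and they converge to the points of `L(α, ρ̂) ∩ Q̂`, which
gives `E₂° ⊆ E`.

For the density, let `ρ̂` tend to `η ∈ E`. If `B (α, η) ≠ 0` for some simple root `α`, the quadratic
function `t ↦ B` on the line through `α` and `η` has a simple zero at `η`, so by the intermediate
value theorem the nearby line `L(α, ρ̂)` meets `Q̂` near `η`. If `η` is in the radical of `B`, its
support is an irreducible affine component, on which `B` is positive semidefinite with kernel `ℝ η`.
The roots of this component have only finitely many mutual products, because two roots whose span
does not contain `η` are conjugate into a finite standard parabolic subsystem. By the pigeonhole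
principle two distinct roots differ by a multiple of `η`; conjugating one of them to a simple root
`α` exhibits `η` on a line `L(α, ρ̂)`. -/

namespace BasedRoot

section PositiveCone

variable {V ι : Type*} [AddCommGroup V] [Module ℝ V]

theorem mem_hull_range_basis_iff (b : Module.Basis ι ℝ V) (v : V) :
    v ∈ PointedCone.hull ℝ (range b) ↔ 0 ≤ b.repr v := by
  constructor
  · intro hv
    induction hv using Submodule.span_induction with
    | mem x hx =>
      obtain ⟨i, rfl⟩ := hx
      rw [b.repr_self]
      exact Finsupp.single_nonneg.2 zero_le_one
    | zero => rw [map_zero]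
    | add x y _ _ hx hy => rw [map_add]; exact add_nonneg hx hy
    | smul c x _ hx =>
      rw [← Nonneg.coe_smul, map_smul]
      exact smul_nonneg c.2 hx
  · intro hv
    rw [← b.linearCombination_repr v]
    exact Submodule.sum_mem _ fun i _ =>
      Submodule.smul_mem _ (⟨b.repr v i, hv i⟩ : {c : ℝ // 0 ≤ c})
        (Submodule.subset_span (mem_range_self i))

theorem mem_posRoots_iff {b : Module.Basis ι ℝ V} {B : LinearMap.BilinForm ℝ V} {ρ : V} :
    ρ ∈ posRoots B (range b) ↔ ρ ∈ roots B (range b) ∧ 0 ≤ b.repr ρ :=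
  and_congr_right fun _ => mem_hull_range_basis_iff b ρ

end PositiveCone

section Reflections

variable {V : Type*} [AddCommGroup V] [Module ℝ V] {B : LinearMap.BilinForm ℝ V}

theorem reflectionMap_apply_of_unit {α : V} (hα : B α α = 1) (v : V) :
    reflectionMap B α v = v - (2 * B α v) • α := by
  rw [reflectionMap_apply, hα, div_one]

theorem reflectionMap_self {α : V} (hα : B α α = 1) : reflectionMap B α α = -α := by
  rw [reflectionMap_apply_of_unit hα, hα]
  module

theorem bilin_reflectionMap (hB : B.IsSymm) {α : V} (hα : B α α ≠ 0) (x y : V) :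
    B (reflectionMap B α x) (reflectionMap B α y) = B x y := by
  simp only [reflectionMap_apply, map_sub, map_smul, LinearMap.sub_apply, LinearMap.smul_apply,
    smul_eq_mul, hB.eq x α]
  field_simp
  ring

theorem reflection_apply {α : V} (hα : B α α ≠ 0) (v : V) :
    reflection B α hα v = reflectionMap B α v :=
  rfl

theorem reflection_mul_self {α : V} (hα : B α α ≠ 0) :
    reflection B α hα * reflection B α hα = 1 :=
  LinearEquiv.ext (reflectionMap_involutive B α hα)

theorem reflection_inv {α : V} (hα : B α α ≠ 0) :
    (reflection B α hα)⁻¹ = reflection B α hα :=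
  inv_eq_of_mul_eq_one_left (reflection_mul_self hα)

theorem apply_reflectionMap {w : V ≃ₗ[ℝ] V} (hw : ∀ x y, B (w x) (w y) = B x y) (α v : V) :
    w (reflectionMap B α v) = reflectionMap B (w α) (w v) := by
  simp only [reflectionMap_apply, map_sub, map_smul, hw]

theorem reflection_mem_weylGroup {Δ : Set V} {α : V} (hα : α ∈ Δ) (hα' : B α α ≠ 0) :
    reflection B α hα' ∈ weylGroup B Δ :=
  Subgroup.subset_closure ⟨α, hα, hα', rfl⟩

theorem weylGroup_induction {Δ : Set V} {p : (w : V ≃ₗ[ℝ] V) → w ∈ weylGroup B Δ → Prop}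
    (one : p 1 (one_mem _))
    (reflection_mul : ∀ α (hα : α ∈ Δ) (hα' : B α α ≠ 0) w hw, p w hw →
      p (reflection B α hα' * w) (mul_mem (reflection_mem_weylGroup hα hα') hw))
    {w : V ≃ₗ[ℝ] V} (hw : w ∈ weylGroup B Δ) : p w hw := by
  induction hw using Subgroup.closure_induction_left with
  | one => exact one
  | mul_left g hg w hw hpw =>
    obtain ⟨α, hα, hα', rfl⟩ := hg
    exact reflection_mul α hα hα' w hw hpw
  | inv_mul_cancel g hg w hw hpw =>
    obtain ⟨α, hα, hα', rfl⟩ := hg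
    simpa only [reflection_inv] using reflection_mul α hα hα' w hw hpw

theorem bilin_weylGroup_apply (hB : B.IsSymm) {Δ : Set V} {w : V ≃ₗ[ℝ] V}
    (hw : w ∈ weylGroup B Δ) (x y : V) : B (w x) (w y) = B x y := by
  induction hw using weylGroup_induction with
  | one => rfl
  | reflection_mul α _ hα w _ hw => exact (bilin_reflectionMap hB hα _ _).trans hw

theorem apply_mem_roots {Δ : Set V} {w : V ≃ₗ[ℝ] V} (hw : w ∈ weylGroup B Δ) {ρ : V}
    (hρ : ρ ∈ roots B Δ) : w ρ ∈ roots B Δ := by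
  obtain ⟨g, hg, α, hα, rfl⟩ := hρ
  exact ⟨w * g, mul_mem hw hg, α, hα, rfl⟩

theorem subset_roots {Δ : Set V} : Δ ⊆ roots B Δ := fun α hα => ⟨1, one_mem _, α, hα, rfl⟩

theorem exists_weylGroup_eq_reflectionMap (hB : B.IsSymm) {Δ : Set V}
    (hunit : ∀ α ∈ Δ, B α α = 1) {ρ : V} (hρ : ρ ∈ roots B Δ) :
    ∃ g ∈ weylGroup B Δ, ∀ v, g v = reflectionMap B ρ v := by
  obtain ⟨w, hw, α, hα, rfl⟩ := hρ
  have hα' : B α α ≠ 0 := by rw [hunit α hα]; exact one_ne_zero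
  refine ⟨w * reflection B α hα' * w⁻¹,
    mul_mem (mul_mem hw (reflection_mem_weylGroup hα hα')) (inv_mem hw), fun v => ?_⟩
  rw [LinearEquiv.mul_apply, LinearEquiv.mul_apply, reflection_apply,
    apply_reflectionMap (bilin_weylGroup_apply hB hw), LinearEquiv.coe_inv, w.apply_symm_apply]

theorem bilin_root_self (hB : B.IsSymm) {Δ : Set V} (hunit : ∀ α ∈ Δ, B α α = 1) {ρ : V}
    (hρ : ρ ∈ roots B Δ) : B ρ ρ = 1 := by
  obtain ⟨w, hw, α, hα, rfl⟩ := hρ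
  rw [bilin_weylGroup_apply hB hw, hunit α hα]

theorem reflectionMap_mem_roots (hB : B.IsSymm) {Δ : Set V} (hunit : ∀ α ∈ Δ, B α α = 1)
    {ρ σ : V} (hρ : ρ ∈ roots B Δ) (hσ : σ ∈ roots B Δ) : reflectionMap B ρ σ ∈ roots B Δ := by
  obtain ⟨g, hg, hgρ⟩ := exists_weylGroup_eq_reflectionMap hB hunit hρ
  rw [← hgρ]
  exact apply_mem_roots hg hσ

theorem neg_mem_roots (hB : B.IsSymm) {Δ : Set V} (hunit : ∀ α ∈ Δ, B α α = 1) {ρ : V}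
    (hρ : ρ ∈ roots B Δ) : -ρ ∈ roots B Δ := by
  rw [← reflectionMap_self (bilin_root_self hB hunit hρ)]
  exact reflectionMap_mem_roots hB hunit hρ hρ

end Reflections

section Dihedral

open Polynomial

theorem add_one_le_eval_chebyshev_U {a : ℝ} (ha : 1 ≤ a) (n : ℕ) :
    (n : ℝ) + 1 ≤ (Chebyshev.U ℝ n).eval a := by
  suffices h : (n : ℝ) + 1 ≤ (Chebyshev.U ℝ n).eval a ∧
      (Chebyshev.U ℝ n).eval a + 1 ≤ (Chebyshev.U ℝ (n + 1)).eval a from h.1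
  induction n with
  | zero => norm_num [Chebyshev.U_zero, Chebyshev.U_one]; linarith
  | succ n ih =>
    obtain ⟨h₀, h₁⟩ := ih
    have hrec : (Chebyshev.U ℝ (n + 1 + 1)).eval a =
        2 * a * (Chebyshev.U ℝ (n + 1)).eval a - (Chebyshev.U ℝ n).eval a := by
      simp [Chebyshev.U_add_one ℝ (n + 1 : ℤ)]
    push_cast
    exact ⟨by linarith, by rw [hrec]; nlinarith [n.cast_nonneg (α := ℝ)]⟩

theorem eval_chebyshev_U_nonneg_of_one_le {a : ℝ} (ha : 1 ≤ a) {n : ℤ} (hn : -1 ≤ n) :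
    0 ≤ (Chebyshev.U ℝ n).eval a := by
  obtain rfl | hn := hn.eq_or_lt
  · simp
  · lift n to ℕ using by omega
    exact le_trans (by positivity) (add_one_le_eval_chebyshev_U ha n)

theorem sin_pi_div_pos {k : ℕ} (hk : 2 ≤ k) : 0 < Real.sin (Real.pi / k) := by
  have hk' : (2 : ℝ) ≤ k := mod_cast hk
  exact Real.sin_pos_of_pos_of_lt_pi (by positivity) (div_lt_self Real.pi_pos (by linarith))

theorem eval_chebyshev_U_cos_pi_div_nonneg {k : ℕ} (hk : 2 ≤ k) {n : ℤ} (hn : -1 ≤ n)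
    (hnk : n < k) : 0 ≤ (Chebyshev.U ℝ n).eval (Real.cos (Real.pi / k)) := by
  have hk' : (k : ℝ) ≠ 0 := mod_cast (by omega : k ≠ 0)
  have hn' : (0 : ℝ) ≤ n + 1 := mod_cast (by omega : 0 ≤ n + 1)
  have hnk' : (n : ℝ) + 1 ≤ k := mod_cast (by omega : n + 1 ≤ k)
  refine nonneg_of_mul_nonneg_left ?_ (sin_pi_div_pos hk)
  rw [Chebyshev.U_real_cos]
  refine Real.sin_nonneg_of_nonneg_of_le_pi (by positivity) ?_
  calc (n + 1) * (Real.pi / k) ≤ k * (Real.pi / k) := by gcongr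
    _ = Real.pi := mul_div_cancel₀ _ hk'

variable {V : Type*} [AddCommGroup V] [Module ℝ V] {B : LinearMap.BilinForm ℝ V}

/-- The vectors `U_n(a) σ + U_{n-1}(a) τ`, where `a = -B(σ, τ)` and `U_n` are the Chebyshev
polynomials of the second kind. For unit vectors they form the orbit of `σ` under the dihedral
group generated by the reflections in `σ` and `τ`, see `reflectionMap_dihedralVec`. -/
noncomputable def dihedralVec (B : LinearMap.BilinForm ℝ V) (σ τ : V) (n : ℤ) : V :=
  (Chebyshev.U ℝ n).eval (-B σ τ) • σ + (Chebyshev.U ℝ (n - 1)).eval (-B σ τ) • τ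

theorem dihedralVec_zero (σ τ : V) : dihedralVec B σ τ 0 = σ := by
  simp [dihedralVec]

theorem reflectionMap_dihedralVec (hB : B.IsSymm) {τ : V} (hτ : B τ τ = 1) (σ : V) (n : ℤ) :
    reflectionMap B τ (dihedralVec B σ τ n) = dihedralVec B τ σ (n + 1) := by
  have hrec := Chebyshev.U_add_one ℝ n
  simp only [dihedralVec, reflectionMap_apply_of_unit hτ, map_add, map_smul, smul_eq_mul, hτ,
    hB.eq σ τ, hrec, Polynomial.eval_sub, Polynomial.eval_mul, Polynomial.eval_ofNat,
    Polynomial.eval_X, add_sub_cancel_right]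
  module

theorem dihedralVec_mem_roots (hB : B.IsSymm) {Δ : Set V} (hunit : ∀ α ∈ Δ, B α α = 1) (n : ℕ)
    {σ τ : V} (hσ : σ ∈ roots B Δ) (hτ : τ ∈ roots B Δ) : dihedralVec B σ τ n ∈ roots B Δ := by
  induction n generalizing σ τ with
  | zero => rwa [Nat.cast_zero, dihedralVec_zero]
  | succ n ih =>
    rw [Nat.cast_succ, ← reflectionMap_dihedralVec hB (bilin_root_self hB hunit hσ)]
    exact reflectionMap_mem_roots hB hunit hσ (ih hτ hσ)

end Dihedral

section CoxeterRelations

open Polynomial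

variable {V : Type*} [AddCommGroup V] [Module ℝ V] {B : LinearMap.BilinForm ℝ V}

theorem eval_chebyshev_U_cos_pi_div_add_two_mul {k : ℕ} (hk : 2 ≤ k) (n : ℤ) :
    (Chebyshev.U ℝ (n + 2 * k)).eval (Real.cos (Real.pi / k)) =
      (Chebyshev.U ℝ n).eval (Real.cos (Real.pi / k)) := by
  have hangle : ((n + 2 * k : ℤ) + 1 : ℝ) * (Real.pi / k) =
      (n + 1) * (Real.pi / k) + 2 * Real.pi := by
    push_cast
    field_simp
    ring
  refine mul_right_cancel₀ (sin_pi_div_pos hk).ne' ?_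
  rw [Chebyshev.U_real_cos, Chebyshev.U_real_cos, hangle, Real.sin_add_two_pi]

theorem eq_zero_of_mem_span_pair (hB : B.IsSymm) {σ τ u : V} (hσ : B σ σ = 1) (hτ : B τ τ = 1)
    (hστ : B σ τ ^ 2 ≠ 1) (hu : u ∈ Submodule.span ℝ {σ, τ}) (huσ : B u σ = 0) (huτ : B u τ = 0) :
    u = 0 := by
  obtain ⟨x, y, rfl⟩ := Submodule.mem_span_pair.1 hu
  simp only [map_add, map_smul, LinearMap.add_apply, LinearMap.smul_apply, smul_eq_mul, hσ, hτ,
    hB.eq τ σ] at huσ huτ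
  have hdet : 1 - B σ τ ^ 2 ≠ 0 := sub_ne_zero.2 hστ.symm
  have hx : x = 0 := mul_right_cancel₀ hdet (by linear_combination huσ - B σ τ * huτ)
  have hy : y = 0 := mul_right_cancel₀ hdet (by linear_combination huτ - B σ τ * huσ)
  rw [hx, hy, zero_smul, zero_smul, add_zero]

theorem sub_reflectionMap_mem_span (α v : V) : v - reflectionMap B α v ∈ Submodule.span ℝ {α} := by
  rw [reflectionMap_apply, sub_sub_cancel]
  exact Submodule.smul_mem _ _ (Submodule.mem_span_singleton_self α)

variable {σ τ : V} {hσ' : B σ σ ≠ 0} {hτ' : B τ τ ≠ 0}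

theorem reflection_mul_reflection_pow_dihedralVec (hB : B.IsSymm) (hσ : B σ σ = 1)
    (hτ : B τ τ = 1) (n : ℕ) (m : ℤ) :
    ((reflection B σ hσ' * reflection B τ hτ') ^ n) (dihedralVec B σ τ m) =
      dihedralVec B σ τ (m + 2 * n) := by
  induction n generalizing m with
  | zero => simp
  | succ n ih =>
    rw [pow_succ, LinearEquiv.mul_apply, LinearEquiv.mul_apply, reflection_apply,
      reflection_apply, reflectionMap_dihedralVec hB hτ, reflectionMap_dihedralVec hB hσ, ih]
    congr 1
    push_cast
    ring

theorem sub_reflection_mul_reflection_pow_mem_span (n : ℕ) (v : V) :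
    v - ((reflection B σ hσ' * reflection B τ hτ') ^ n) v ∈ Submodule.span ℝ {σ, τ} := by
  have hstep : ∀ {α : V} (hα : B α α ≠ 0) (x : V), α ∈ ({σ, τ} : Set V) →
      x - reflection B α hα x ∈ Submodule.span ℝ {σ, τ} := fun hα x h =>
    Submodule.span_mono (singleton_subset_iff.2 h) (sub_reflectionMap_mem_span _ x)
  induction n with
  | zero => simp
  | succ n ih =>
    rw [pow_succ', LinearEquiv.mul_apply, LinearEquiv.mul_apply]
    set x := ((reflection B σ hσ' * reflection B τ hτ') ^ n) v
    rw [← sub_add_sub_cancel v x, ← sub_add_sub_cancel x (reflection B τ hτ' x)]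
    exact add_mem ih (add_mem (hstep hτ' _ (mem_insert_of_mem _ rfl))
      (hstep hσ' _ (mem_insert σ _)))

theorem reflection_mul_reflection_pow_eq_one (hB : B.IsSymm) (hσ : B σ σ = 1) (hτ : B τ τ = 1)
    {k : ℕ} (hk : 2 ≤ k) (hστ : B σ τ = -Real.cos (Real.pi / k)) :
    (reflection B σ hσ' * reflection B τ hτ') ^ k = 1 := by
  set T := reflection B σ hσ' * reflection B τ hτ' with hT
  have hperiodic : ∀ m : ℤ, (T ^ k) (dihedralVec B σ τ m) = dihedralVec B σ τ m := fun m => by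
    rw [hT, reflection_mul_reflection_pow_dihedralVec hB hσ hτ, dihedralVec, dihedralVec,
      add_sub_right_comm, hστ, neg_neg, eval_chebyshev_U_cos_pi_div_add_two_mul hk,
      eval_chebyshev_U_cos_pi_div_add_two_mul hk]
  have hTσ : (T ^ k) σ = σ := by simpa only [dihedralVec_zero] using hperiodic 0
  have hTτ : (T ^ k) τ = τ := by simpa [dihedralVec, Chebyshev.U_neg_two] using hperiodic (-1)
  have hTB : ∀ x y, B ((T ^ k) x) ((T ^ k) y) = B x y := by
    have hmem : T ^ k ∈ weylGroup B {σ, τ} := pow_mem (mul_mem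
      (reflection_mem_weylGroup (mem_insert σ _) hσ')
      (reflection_mem_weylGroup (mem_insert_of_mem σ (mem_singleton τ)) hτ')) k
    exact bilin_weylGroup_apply hB hmem
  have hsq : B σ τ ^ 2 ≠ 1 := by
    have hsin := sin_pi_div_pos hk
    rw [hστ, neg_sq, Real.cos_sq']
    nlinarith
  refine LinearEquiv.ext fun v => (sub_eq_zero.1 (?_ : v - (T ^ k) v = 0)).symm
  refine eq_zero_of_mem_span_pair hB hσ hτ hsq
    (sub_reflection_mul_reflection_pow_mem_span k v) ?_ ?_
  · rw [map_sub, LinearMap.sub_apply, sub_eq_zero, ← hTB v σ, hTσ]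
  · rw [map_sub, LinearMap.sub_apply, sub_eq_zero, ← hTB v τ, hTτ]

end CoxeterRelations

section CoxeterGroup

open CoxeterSystem

variable {ι W : Type*} [Group W] {M : CoxeterMatrix ι} (cs : CoxeterSystem M W)

theorem eq_mul_alternatingWord_succ_or {v : W} {i j x : ι} (hx : x = i ∨ x = j) (n : ℕ)
    (hn : n = 0 → x = j) :
    v * cs.wordProd (alternatingWord i j n) =
        v * cs.simple x * cs.wordProd (alternatingWord i j (n + 1)) ∨
      ∃ m, n = m + 1 ∧ v * cs.wordProd (alternatingWord i j n) =
        v * cs.simple x * cs.wordProd (alternatingWord i j m) := by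
  by_cases hxn : x = if Even n then j else i
  · left
    rw [alternatingWord_succ', ← hxn, cs.wordProd_cons, ← mul_assoc,
      cs.simple_mul_simple_cancel_right]
  · right
    cases n with
    | zero => exact absurd (hn rfl) (by simpa using hxn)
    | succ m =>
      have hxm : x = if Even m then j else i := by
        simp only [Nat.even_add_one] at hxn
        split_ifs at hxn ⊢ <;> tauto
      exact ⟨m, rfl, by rw [alternatingWord_succ', ← hxm, cs.wordProd_cons, mul_assoc]⟩

theorem exists_eq_mul_alternatingWord {w : W} {i : ι} (hi : ¬cs.IsRightDescent w i) (j : ι) :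
    ∃ v n, w = v * cs.wordProd (alternatingWord i j n) ∧ cs.length w = cs.length v + n ∧
      ¬cs.IsRightDescent v i ∧ ¬cs.IsRightDescent v j := by
  classical
  have hex : ∃ k v n, cs.length v = k ∧ w = v * cs.wordProd (alternatingWord i j n) ∧
      cs.length w = cs.length v + n := ⟨_, w, 0, rfl, by simp [alternatingWord], rfl⟩
  obtain ⟨v, n, hv, hw, hlen⟩ := Nat.find_spec hex
  have hmin : ∀ v' n', w = v' * cs.wordProd (alternatingWord i j n') →
      cs.length w = cs.length v' + n' → cs.length v ≤ cs.length v' := fun v' n' hw' hlen' =>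
    hv.trans_le (Nat.find_min' hex ⟨v', n', rfl, hw', hlen'⟩)
  have hnot : ∀ x, (x = i ∨ x = j) → (n = 0 → x = j) → ¬cs.IsRightDescent v x := by
    intro x hx hn hdesc
    rw [cs.isRightDescent_iff] at hdesc
    rcases eq_mul_alternatingWord_succ_or cs (v := v) hx n hn with h | ⟨m, rfl, h⟩
    · have := hmin _ _ (hw.trans h) (by omega)
      omega
    · have hle := cs.length_mul_le (v * cs.simple x) (cs.wordProd (alternatingWord i j m))
      have hle' := cs.length_wordProd_le (alternatingWord i j m)
      rw [← h, ← hw] at hle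
      rw [length_alternatingWord] at hle'
      omega
  refine ⟨v, n, hw, hlen, ?_, hnot j (.inr rfl) fun _ => rfl⟩
  obtain rfl | hn := eq_or_ne n 0
  · rwa [hw, alternatingWord, cs.wordProd_nil, mul_one] at hi
  · exact hnot i (.inl rfl) fun h => absurd h hn

theorem lt_of_not_isRightDescent_mul_alternatingWord {v : W} {i j : ι} {n : ℕ}
    (hlen : cs.length (v * cs.wordProd (alternatingWord i j n)) = cs.length v + n)
    (hi : ¬cs.IsRightDescent (v * cs.wordProd (alternatingWord i j n)) i) (hM : M i j ≠ 0) :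
    n < M i j := by
  rw [cs.not_isRightDescent_iff, mul_assoc, ← cs.wordProd_concat, ← alternatingWord_succ] at hi
  have hle := cs.length_mul_le v (cs.wordProd (alternatingWord j i (n + 1)))
  have hle' := cs.length_wordProd_le (alternatingWord j i (n + 1))
  have hred : cs.IsReduced (alternatingWord j i (n + 1)) := by
    rw [length_alternatingWord] at hle'
    rw [CoxeterSystem.IsReduced, length_alternatingWord]
    omega
  by_contra! hn
  rw [M.symmetric] at hM hn
  exact cs.not_isReduced_alternatingWord j i hM (Nat.lt_succ_of_le hn) hred

end CoxeterGroup

section GeometricRepresentation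

open CoxeterSystem

variable {V ι : Type*} [AddCommGroup V] [Module ℝ V] {B : LinearMap.BilinForm ℝ V} {α : ι → V}

open scoped Classical in
/-- The Coxeter matrix of a family of vectors: the entry at `i ≠ j` is the `k ≥ 2` with
`B(α i, α j) = -cos (π / k)`, and `0`, Mathlib's encoding of `∞`, if there is no such `k`. -/
noncomputable def coxeterMatrix (hB : B.IsSymm) (α : ι → V) : CoxeterMatrix ι where
  M := Matrix.of fun i j =>
    if i = j then 1 else sInf {k : ℕ | 2 ≤ k ∧ B (α i) (α j) = -Real.cos (Real.pi / k)}
  isSymm := Matrix.IsSymm.ext fun i j => by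
    simp only [Matrix.of_apply, eq_comm (a := i), hB.eq (α i) (α j)]
  diagonal i := if_pos rfl
  off_diagonal i j hij := by
    rw [Matrix.of_apply, if_neg hij]
    intro h
    have hmem := Nat.sInf_mem (Nat.nonempty_of_pos_sInf (h ▸ one_pos))
    rw [h] at hmem
    exact absurd hmem.1 (by norm_num)

theorem coxeterMatrix_of_ne (hB : B.IsSymm) {i j : ι} (hij : i ≠ j) :
    coxeterMatrix hB α i j =
      sInf {k : ℕ | 2 ≤ k ∧ B (α i) (α j) = -Real.cos (Real.pi / k)} :=
  if_neg hij

theorem bilin_eq_of_coxeterMatrix_ne_zero (hB : B.IsSymm) {i j : ι} (hij : i ≠ j)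
    (hM : coxeterMatrix hB α i j ≠ 0) :
    2 ≤ coxeterMatrix hB α i j ∧
      B (α i) (α j) = -Real.cos (Real.pi / coxeterMatrix hB α i j) := by
  rw [coxeterMatrix_of_ne hB hij] at hM ⊢
  exact Nat.sInf_mem (Nat.nonempty_of_pos_sInf (Nat.pos_of_ne_zero hM))

theorem bilin_le_neg_one_of_coxeterMatrix_eq_zero (hB : B.IsSymm)
    (hΔ : IsSimpleSystem B (range α)) (hα : Function.Injective α) {i j : ι} (hij : i ≠ j)
    (hM : coxeterMatrix hB α i j = 0) : B (α i) (α j) ≤ -1 := by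
  refine (hΔ.offDiag _ (mem_range_self i) _ (mem_range_self j) (hα.ne hij)).resolve_right ?_
  rw [coxeterMatrix_of_ne hB hij, Nat.sInf_eq_zero] at hM
  rintro ⟨k, hk, hBk⟩
  rcases hM with hM | hM
  · exact absurd hM.1 (by norm_num)
  · exact (hM ▸ ⟨hk, hBk⟩ : k ∈ (∅ : Set ℕ)).elim

/-- The geometric representation of the Coxeter group of a family of unit vectors, sending the
`i`-th generator to the reflection in `α i`. -/
noncomputable def geomRep (hB : B.IsSymm) (hunit : ∀ β ∈ range α, B β β = 1) :
    (coxeterMatrix hB α).Group →* (V ≃ₗ[ℝ] V) :=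
  (coxeterMatrix hB α).toCoxeterSystem.lift
    ⟨fun i => reflection B (α i) ((hunit _ (mem_range_self i)).trans_ne one_ne_zero), by
      intro i j
      obtain rfl | hij := eq_or_ne i j
      · rw [CoxeterMatrix.diagonal, pow_one, reflection_mul_self]
      obtain hM | hM := eq_or_ne (coxeterMatrix hB α i j) 0
      · rw [hM, pow_zero]
      · obtain ⟨hk, hBk⟩ := bilin_eq_of_coxeterMatrix_ne_zero hB hij hM
        exact reflection_mul_reflection_pow_eq_one hB (hunit _ (mem_range_self i))
          (hunit _ (mem_range_self j)) hk hBk⟩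

variable {hB : B.IsSymm} {hunit : ∀ β ∈ range α, B β β = 1}

theorem geomRep_simple (i : ι) :
    geomRep hB hunit ((coxeterMatrix hB α).toCoxeterSystem.simple i) =
      reflection B (α i) ((hunit _ (mem_range_self i)).trans_ne one_ne_zero) :=
  CoxeterSystem.lift_apply_simple _ _ i

theorem geomRep_simple_apply (i : ι) (v : V) :
    geomRep hB hunit ((coxeterMatrix hB α).toCoxeterSystem.simple i) v =
      reflectionMap B (α i) v := by
  rw [geomRep_simple, reflection_apply]

theorem range_geomRep : (geomRep hB hunit).range = weylGroup B (range α) := by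
  rw [MonoidHom.range_eq_map,
    ← (coxeterMatrix hB α).toCoxeterSystem.subgroup_closure_range_simple, MonoidHom.map_closure,
    ← range_comp, weylGroup]
  congr 1
  ext g
  constructor
  · rintro ⟨i, rfl⟩
    exact ⟨α i, mem_range_self i, _, geomRep_simple i⟩
  · rintro ⟨_, ⟨i, rfl⟩, hi, rfl⟩
    exact ⟨i, geomRep_simple i⟩

theorem geomRep_alternatingWord_apply (i j : ι) (n : ℕ) :
    geomRep hB hunit ((coxeterMatrix hB α).toCoxeterSystem.wordProd (alternatingWord i j n)) (α i) =
      if Even n then dihedralVec B (α i) (α j) n else dihedralVec B (α j) (α i) n := by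
  induction n with
  | zero => simp [alternatingWord, dihedralVec_zero]
  | succ n ih =>
    rw [alternatingWord_succ', wordProd_cons, map_mul, LinearEquiv.mul_apply, ih,
      geomRep_simple_apply]
    have hunit' := fun k => hunit (α k) (mem_range_self k)
    by_cases hn : Even n
    · simp only [hn, Nat.even_add_one, not_true_eq_false, if_true, if_false,
        reflectionMap_dihedralVec hB (hunit' j), Nat.cast_succ]
    · simp only [hn, Nat.even_add_one, not_false_eq_true, if_true, if_false,
        reflectionMap_dihedralVec hB (hunit' i), Nat.cast_succ]

end GeometricRepresentation

section Positivity

open Polynomial CoxeterSystem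

variable {V ι : Type*} [AddCommGroup V] [Module ℝ V] {B : LinearMap.BilinForm ℝ V}
  {b : Module.Basis ι ℝ V}

theorem eval_chebyshev_U_nonneg_of_lt_coxeterMatrix (hB : B.IsSymm)
    (hΔ : IsSimpleSystem B (range b)) {i j : ι} (hij : i ≠ j) {n : ℤ} (hn : -1 ≤ n)
    (hnM : coxeterMatrix hB b i j ≠ 0 → n < coxeterMatrix hB b i j) :
    0 ≤ (Chebyshev.U ℝ n).eval (-B (b i) (b j)) := by
  obtain hM | hM := eq_or_ne (coxeterMatrix hB b i j) 0
  · have hBij := bilin_le_neg_one_of_coxeterMatrix_eq_zero hB hΔ b.injective hij hM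
    exact eval_chebyshev_U_nonneg_of_one_le (by linarith) hn
  · obtain ⟨hk, hBij⟩ := bilin_eq_of_coxeterMatrix_ne_zero hB hij hM
    rw [hBij, neg_neg]
    exact eval_chebyshev_U_cos_pi_div_nonneg hk hn (hnM hM)

theorem exists_geomRep_alternatingWord_apply_eq (hB : B.IsSymm)
    (hΔ : IsSimpleSystem B (range b)) {i j : ι} (hij : i ≠ j) {n : ℕ}
    (hn : coxeterMatrix hB b i j ≠ 0 → n < coxeterMatrix hB b i j) :
    ∃ p q : ℝ, 0 ≤ p ∧ 0 ≤ q ∧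
      geomRep hB hΔ.diag
        ((coxeterMatrix hB b).toCoxeterSystem.wordProd (alternatingWord i j n)) (b i) =
      p • b i + q • b j := by
  have hp := eval_chebyshev_U_nonneg_of_lt_coxeterMatrix hB hΔ hij (n := n) (by omega)
    fun hM => mod_cast hn hM
  have hq := eval_chebyshev_U_nonneg_of_lt_coxeterMatrix hB hΔ hij (n := n - 1) (by omega)
    fun hM => by have := hn hM; omega
  rw [geomRep_alternatingWord_apply]
  split_ifs
  · exact ⟨_, _, hp, hq, rfl⟩
  · rw [dihedralVec, hB.eq (b j) (b i), add_comm]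
    exact ⟨_, _, hq, hp, rfl⟩

theorem repr_geomRep_nonneg (hB : B.IsSymm) (hΔ : IsSimpleSystem B (range b))
    {w : (coxeterMatrix hB b).Group} {i : ι}
    (hi : ¬(coxeterMatrix hB b).toCoxeterSystem.IsRightDescent w i) :
    0 ≤ b.repr (geomRep hB hΔ.diag w (b i)) := by
  set cs := (coxeterMatrix hB b).toCoxeterSystem
  induction hl : cs.length w using Nat.strong_induction_on generalizing w i with
  | _ l ih =>
  subst hl
  obtain rfl | hw := eq_or_ne w 1
  · rw [map_one, LinearEquiv.coe_one, id, b.repr_self]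
    exact Finsupp.single_nonneg.2 zero_le_one
  obtain ⟨j, hj⟩ := cs.exists_rightDescent_of_ne_one hw
  have hij : i ≠ j := by
    rintro rfl
    exact hi hj
  obtain ⟨v, n, rfl, hlen, hvi, hvj⟩ := exists_eq_mul_alternatingWord cs hi j
  have hlt : cs.length v < cs.length (v * cs.wordProd (alternatingWord i j n)) := by
    refine lt_of_le_of_ne (hlen ▸ Nat.le_add_right _ _) fun h => ?_
    rw [hlen, left_eq_add] at h
    rw [h, alternatingWord, cs.wordProd_nil, mul_one] at hj
    exact hvj hj
  obtain ⟨p, q, hp, hq, hpq⟩ := exists_geomRep_alternatingWord_apply_eq hB hΔ hij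
    (lt_of_not_isRightDescent_mul_alternatingWord cs hlen hi)
  rw [map_mul, LinearEquiv.mul_apply, hpq]
  simp only [map_add, map_smul]
  exact add_nonneg (smul_nonneg hp (ih _ hlt hvi rfl)) (smul_nonneg hq (ih _ hlt hvj rfl))

theorem repr_geomRep_nonpos (hB : B.IsSymm) (hΔ : IsSimpleSystem B (range b))
    {w : (coxeterMatrix hB b).Group} {i : ι}
    (hi : (coxeterMatrix hB b).toCoxeterSystem.IsRightDescent w i) :
    b.repr (geomRep hB hΔ.diag w (b i)) ≤ 0 := by
  rw [isRightDescent_iff_not_isRightDescent_mul] at hi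
  have hnonneg := repr_geomRep_nonneg hB hΔ hi
  rwa [map_mul, LinearEquiv.mul_apply, geomRep_simple_apply,
    reflectionMap_self (hΔ.diag _ (mem_range_self i)), map_neg, map_neg, neg_nonneg] at hnonneg

theorem repr_nonneg_or_nonpos (hB : B.IsSymm) (hΔ : IsSimpleSystem B (range b)) {ρ : V}
    (hρ : ρ ∈ roots B (range b)) : 0 ≤ b.repr ρ ∨ b.repr ρ ≤ 0 := by
  obtain ⟨w, hw, _, ⟨i, rfl⟩, rfl⟩ := hρ
  rw [← range_geomRep (hB := hB) (hunit := hΔ.diag)] at hw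
  obtain ⟨g, rfl⟩ := hw
  by_cases hi : (coxeterMatrix hB b).toCoxeterSystem.IsRightDescent g i
  · exact .inr (repr_geomRep_nonpos hB hΔ hi)
  · exact .inl (repr_geomRep_nonneg hB hΔ hi)

theorem eq_one_of_forall_repr_nonneg (hB : B.IsSymm) (hΔ : IsSimpleSystem B (range b))
    {w : V ≃ₗ[ℝ] V} (hw : w ∈ weylGroup B (range b)) (hnonneg : ∀ i, 0 ≤ b.repr (w (b i))) :
    w = 1 := by
  rw [← range_geomRep (hB := hB) (hunit := hΔ.diag)] at hw
  obtain ⟨g, rfl⟩ := hw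
  by_contra hg
  obtain ⟨i, hi⟩ := (coxeterMatrix hB b).toCoxeterSystem.exists_rightDescent_of_ne_one
    (ne_of_apply_ne (geomRep hB hΔ.diag) (ne_of_ne_of_eq hg (map_one _).symm))
  have hzero := le_antisymm (repr_geomRep_nonpos hB hΔ hi) (hnonneg i)
  rw [map_eq_zero_iff _ b.repr.injective, map_eq_zero_iff _ (LinearEquiv.injective _)] at hzero
  exact b.ne_zero i hzero

theorem repr_reflectionMap_of_ne {i k : ι} (hki : k ≠ i) (v : V) :
    b.repr (reflectionMap B (b i) v) k = b.repr v k := by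
  classical
  rw [reflectionMap_apply, map_sub, map_smul, b.repr_self, Finsupp.sub_apply, Finsupp.smul_apply,
    Finsupp.single_eq_of_ne hki, smul_zero, sub_zero]

end Positivity

section PositiveRoots

variable {V ι : Type*} [AddCommGroup V] [Module ℝ V] {B : LinearMap.BilinForm ℝ V}
  {b : Module.Basis ι ℝ V}

theorem mem_posRoots_or_neg_mem_posRoots (hB : B.IsSymm) (hΔ : IsSimpleSystem B (range b)) {ρ : V}
    (hρ : ρ ∈ roots B (range b)) : ρ ∈ posRoots B (range b) ∨ -ρ ∈ posRoots B (range b) := by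
  simp only [mem_posRoots_iff, map_neg, neg_nonneg]
  exact (repr_nonneg_or_nonpos hB hΔ hρ).imp (⟨hρ, ·⟩) (⟨neg_mem_roots hB hΔ.diag hρ, ·⟩)

theorem exists_repr_pos_of_ne (hB : B.IsSymm) (hΔ : IsSimpleSystem B (range b)) {ρ : V}
    (hρ : ρ ∈ posRoots B (range b)) {i : ι} (hi : ρ ≠ b i) : ∃ k, k ≠ i ∧ 0 < b.repr ρ k := by
  obtain ⟨hρ, hnonneg⟩ := mem_posRoots_iff.1 hρ
  by_contra! h
  have hsingle : b.repr ρ = Finsupp.single i (b.repr ρ i) :=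
    Finsupp.ext fun k => by
      obtain rfl | hk := eq_or_ne k i
      · rw [Finsupp.single_eq_same]
      · rw [Finsupp.single_eq_of_ne hk, le_antisymm (h k hk) (hnonneg k)]
  have hρi : ρ = b.repr ρ i • b i := by
    rw [← b.repr_symm_single, ← hsingle, LinearEquiv.symm_apply_apply]
  have hsq : b.repr ρ i * b.repr ρ i = 1 := by
    have hunit := bilin_root_self hB hΔ.diag hρ
    rw [hρi] at hunit
    simpa [hΔ.diag _ (mem_range_self i)] using hunit
  have hone : b.repr ρ i = 1 := by
    have hρi_nonneg : 0 ≤ b.repr ρ i := hnonneg i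
    nlinarith
  exact hi (by rw [hρi, hone, one_smul])

theorem reflectionMap_mem_posRoots (hB : B.IsSymm) (hΔ : IsSimpleSystem B (range b)) {ρ : V}
    (hρ : ρ ∈ posRoots B (range b)) {i : ι} (hi : ρ ≠ b i) :
    reflectionMap B (b i) ρ ∈ posRoots B (range b) := by
  obtain ⟨k, hki, hk⟩ := exists_repr_pos_of_ne hB hΔ hρ hi
  have hroot := reflectionMap_mem_roots hB hΔ.diag (subset_roots (mem_range_self i)) hρ.1
  refine mem_posRoots_iff.2 ⟨hroot, (repr_nonneg_or_nonpos hB hΔ hroot).resolve_right fun h => ?_⟩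
  have hle : b.repr (reflectionMap B (b i) ρ) k ≤ 0 := h k
  rw [repr_reflectionMap_of_ne hki] at hle
  exact hk.not_ge hle

end PositiveRoots

section Coordinates

variable {V ι : Type*} [AddCommGroup V] [Module ℝ V] [Fintype ι] {b : Module.Basis ι ℝ V}

theorem coordSum_add (b : Module.Basis ι ℝ V) (u v : V) :
    coordSum b (u + v) = coordSum b u + coordSum b v := by
  simp only [coordSum, map_add, Finsupp.add_apply, Finset.sum_add_distrib]

theorem coordSum_smul (b : Module.Basis ι ℝ V) (c : ℝ) (v : V) :
    coordSum b (c • v) = c * coordSum b v := by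
  simp only [coordSum, map_smul, Finsupp.smul_apply, smul_eq_mul, Finset.mul_sum]

theorem coordSum_neg (b : Module.Basis ι ℝ V) (v : V) : coordSum b (-v) = -coordSum b v := by
  simp only [coordSum, map_neg, Finsupp.neg_apply, Finset.sum_neg_distrib]

theorem coordSum_basis (b : Module.Basis ι ℝ V) (i : ι) : coordSum b (b i) = 1 := by
  classical
  simp only [coordSum, b.repr_self, Finsupp.single_apply, Finset.sum_ite_eq, Finset.mem_univ,
    if_true]

theorem coordSum_normalize {v : V} (h : coordSum b v ≠ 0) : coordSum b (normalize b v) = 1 := by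
  rw [normalize, coordSum_smul, inv_mul_cancel₀ h]

theorem normalize_smul {c : ℝ} (hc : c ≠ 0) (v : V) : normalize b (c • v) = normalize b v := by
  rw [normalize, normalize, coordSum_smul, smul_smul, mul_inv_rev, mul_assoc, inv_mul_cancel₀ hc,
    mul_one]

theorem normalize_neg (v : V) : normalize b (-v) = normalize b v := by
  rw [← neg_one_smul ℝ v, normalize_smul (by norm_num)]

theorem normalize_eq_self {v : V} (h : coordSum b v = 1) : normalize b v = v := by
  rw [normalize, h, inv_one, one_smul]

theorem coordSum_pos {v : V} (hv : 0 ≤ b.repr v) (hv0 : v ≠ 0) : 0 < coordSum b v := by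
  refine (Finset.sum_nonneg fun i _ => hv i).lt_of_ne fun hsum => hv0 ?_
  refine b.ext_elem fun i => ?_
  rw [map_zero, Finsupp.zero_apply]
  exact (Finset.sum_eq_zero_iff_of_nonneg fun i _ => hv i).1 hsum.symm i (Finset.mem_univ i)

theorem repr_normalize_nonneg {v : V} (hv : 0 ≤ b.repr v) : 0 ≤ b.repr (normalize b v) := by
  rw [normalize, map_smul]
  exact smul_nonneg (inv_nonneg.2 (Finset.sum_nonneg fun i _ => hv i)) hv

end Coordinates

section RootCoordinates

variable {V ι : Type*} [AddCommGroup V] [Module ℝ V] {b : Module.Basis ι ℝ V}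
  {B : LinearMap.BilinForm ℝ V}

theorem root_ne_zero (hB : B.IsSymm) {Δ : Set V} (hunit : ∀ α ∈ Δ, B α α = 1) {ρ : V}
    (hρ : ρ ∈ roots B Δ) : ρ ≠ 0 := by
  rintro rfl
  have hzero := bilin_root_self hB hunit hρ
  rw [map_zero] at hzero
  exact zero_ne_one hzero

variable [Fintype ι]

theorem coordSum_posRoot_pos (hB : B.IsSymm) (hΔ : IsSimpleSystem B (range b)) {ρ : V}
    (hρ : ρ ∈ posRoots B (range b)) : 0 < coordSum b ρ :=
  have ⟨hρ, hnonneg⟩ := mem_posRoots_iff.1 hρ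
  coordSum_pos hnonneg (root_ne_zero hB hΔ.diag hρ)

theorem coordSum_root_ne_zero (hB : B.IsSymm) (hΔ : IsSimpleSystem B (range b)) {ρ : V}
    (hρ : ρ ∈ roots B (range b)) : coordSum b ρ ≠ 0 := by
  obtain hρ | hρ := mem_posRoots_or_neg_mem_posRoots hB hΔ hρ
  · exact (coordSum_posRoot_pos hB hΔ hρ).ne'
  · exact neg_ne_zero.1 (coordSum_neg b ρ ▸ (coordSum_posRoot_pos hB hΔ hρ).ne')

theorem bilin_normalize_root (hB : B.IsSymm) (hΔ : IsSimpleSystem B (range b)) {ρ : V}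
    (hρ : ρ ∈ roots B (range b)) :
    B (normalize b ρ) (normalize b ρ) = (coordSum b ρ)⁻¹ ^ 2 := by
  simp only [normalize, map_smul, LinearMap.smul_apply, bilin_root_self hB hΔ.diag hρ, smul_eq_mul,
    mul_one, sq]

end RootCoordinates

section Continuity

variable {V ι : Type*} [NormedAddCommGroup V] [NormedSpace ℝ V]

theorem continuous_bilin [FiniteDimensional ℝ V] (B : LinearMap.BilinForm ℝ V) :
    Continuous fun p : V × V => B p.1 p.2 :=
  B.toContinuousBilinearMap.continuous₂

theorem continuousAt_reflectionMap [FiniteDimensional ℝ V] {B : LinearMap.BilinForm ℝ V} {x : V}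
    (hx : B x x ≠ 0) (v : V) :
    ContinuousAt (fun p : V × V => reflectionMap B p.1 p.2) (x, v) := by
  have hB := continuous_bilin B
  have hdiag : ContinuousAt (fun p : V × V => B p.1 p.1) (x, v) :=
    (hB.comp (continuous_fst.prodMk continuous_fst)).continuousAt
  simp only [reflectionMap_apply]
  exact continuousAt_snd.sub
    ((continuousAt_const.mul (hB.continuousAt.div hdiag hx)).smul continuousAt_fst)

theorem continuous_coord [Finite ι] (b : Module.Basis ι ℝ V) (i : ι) :
    Continuous fun v => b.repr v i :=
  have : FiniteDimensional ℝ V := b.finiteDimensional_of_finite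
  (b.coord i).continuous_of_finiteDimensional

theorem isClosed_repr_nonneg [Finite ι] (b : Module.Basis ι ℝ V) :
    IsClosed {v | 0 ≤ b.repr v} := by
  simp only [Finsupp.le_def, ofPred_forall]
  exact isClosed_iInter fun i => isClosed_le continuous_const (continuous_coord b i)

variable [Fintype ι]

theorem continuous_coordSum (b : Module.Basis ι ℝ V) : Continuous (coordSum b) :=
  continuous_finsetSum _ fun i _ => continuous_coord b i

theorem continuousAt_normalize {b : Module.Basis ι ℝ V} {v : V} (h : coordSum b v ≠ 0) :
    ContinuousAt (normalize b) v :=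
  ((continuous_coordSum b).continuousAt.inv₀ h).smul continuousAt_id

theorem isCompact_repr_nonneg_coordSum_le (b : Module.Basis ι ℝ V) (C : ℝ) :
    IsCompact {v | 0 ≤ b.repr v ∧ coordSum b v ≤ C} := by
  have hcube : IsCompact (b.equivFun.symm '' Icc (0 : ι → ℝ) fun _ => C) :=
    isCompact_Icc.image b.equivFun.symm.toLinearMap.continuous_of_finiteDimensional
  refine hcube.of_isClosed_subset
    ((isClosed_repr_nonneg b).inter (isClosed_le (continuous_coordSum b) continuous_const)) ?_
  rintro v ⟨hv, hvC⟩
  refine ⟨b.equivFun v, ⟨fun i => hv i, fun i => ?_⟩, b.equivFun.symm_apply_apply v⟩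
  exact (Finset.single_le_sum (fun i _ => hv i) (Finset.mem_univ i)).trans hvC

end Continuity

section Discreteness

variable {V ι : Type*} [AddCommGroup V] [Module ℝ V] {b : Module.Basis ι ℝ V}
  {B : LinearMap.BilinForm ℝ V}

theorem eq_of_reflectionMap_eq_neg {ρ σ : V} (hρ : B ρ ρ = 1) (hσ : B σ σ = 1)
    (hρσ : 0 < B ρ σ) (h : reflectionMap B ρ σ = -σ) : ρ = σ := by
  have hσρ : σ = B ρ σ • ρ := by
    rw [reflectionMap_apply_of_unit hρ] at h
    refine smul_right_injective V (two_ne_zero (α := ℝ)) ?_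
    linear_combination (norm := module) h
  have hone : B ρ σ = 1 := by
    rw [hσρ, map_smul, map_smul, LinearMap.smul_apply, hρ, smul_eq_mul, smul_eq_mul] at hσ
    nlinarith
  rw [hσρ, hone, one_smul]

theorem eq_of_forall_repr_reflectionMap_reflectionMap_pos (hB : B.IsSymm)
    (hΔ : IsSimpleSystem B (range b)) {ρ σ : V} (hρ : ρ ∈ roots B (range b))
    (hσ : σ ∈ roots B (range b)) (hρσ : 0 < B ρ σ)
    (hpos : ∀ i, 0 < b.repr (reflectionMap B ρ (reflectionMap B σ (b i))) i) : ρ = σ := by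
  have hρ1 := bilin_root_self hB hΔ.diag hρ
  have hσ1 := bilin_root_self hB hΔ.diag hσ
  obtain ⟨g, hg, hgρ⟩ := exists_weylGroup_eq_reflectionMap hB hΔ.diag hρ
  obtain ⟨g', hg', hgσ⟩ := exists_weylGroup_eq_reflectionMap hB hΔ.diag hσ
  have hone : g * g' = 1 := by
    refine eq_one_of_forall_repr_nonneg hB hΔ (mul_mem hg hg') fun i => ?_
    refine (repr_nonneg_or_nonpos hB hΔ (apply_mem_roots (mul_mem hg hg')
      (subset_roots (mem_range_self i)))).resolve_right fun hnonpos => ?_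
    have hi := hpos i
    rw [← hgσ, ← hgρ] at hi
    exact hi.not_ge (hnonpos i)
  refine eq_of_reflectionMap_eq_neg hρ1 hσ1 hρσ ?_
  have hfix : g (g' σ) = σ := by rw [← LinearEquiv.mul_apply, hone, LinearEquiv.coe_one, id]
  rw [hgσ, reflectionMap_self hσ1, map_neg, hgρ] at hfix
  rw [← hfix, neg_neg, hfix]

end Discreteness

section Discreteness

open Filter

variable {V ι : Type*} [NormedAddCommGroup V] [NormedSpace ℝ V] {b : Module.Basis ι ℝ V}
  {B : LinearMap.BilinForm ℝ V}

theorem eventually_roots_eq [Finite ι] (hB : B.IsSymm) (hΔ : IsSimpleSystem B (range b)) {x : V}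
    (hx : 0 < B x x) :
    ∀ᶠ p : V × V in 𝓝 (x, x), p.1 ∈ roots B (range b) → p.2 ∈ roots B (range b) → p.1 = p.2 := by
  have : FiniteDimensional ℝ V := b.finiteDimensional_of_finite
  have hpos : ∀ᶠ p : V × V in 𝓝 (x, x),
      ∀ i, 0 < b.repr (reflectionMap B p.1 (reflectionMap B p.2 (b i))) i := by
    refine eventually_all.2 fun i => ?_
    have hinner : ContinuousAt (fun p : V × V => reflectionMap B p.2 (b i)) (x, x) :=
      (continuousAt_reflectionMap hx.ne' (b i)).comp₂_of_eq continuousAt_snd continuousAt_const rfl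
    have hcont : ContinuousAt
        (fun p : V × V => b.repr (reflectionMap B p.1 (reflectionMap B p.2 (b i))) i) (x, x) :=
      (continuous_coord b i).continuousAt.comp <|
        (continuousAt_reflectionMap hx.ne' _).comp₂_of_eq continuousAt_fst hinner rfl
    refine hcont.eventually (lt_mem_nhds ?_)
    beta_reduce
    rw [reflectionMap_involutive B x hx.ne', b.repr_self, Finsupp.single_eq_same]
    exact zero_lt_one
  filter_upwards [hpos, (continuous_bilin B).continuousAt.eventually (lt_mem_nhds hx)]
    with p hp hBp hp1 hp2
  exact eq_of_forall_repr_reflectionMap_reflectionMap_pos hB hΔ hp1 hp2 hBp hp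

theorem not_accPt_roots [Finite ι] (hB : B.IsSymm) (hΔ : IsSimpleSystem B (range b)) (x : V) :
    ¬AccPt x (𝓟 (roots B (range b))) := by
  have : FiniteDimensional ℝ V := b.finiteDimensional_of_finite
  intro hx
  have hxB : B x x = 1 := by
    have hclosed : IsClosed {v | B v v = 1} :=
      isClosed_eq ((continuous_bilin B).comp (continuous_id.prodMk continuous_id)) continuous_const
    exact hclosed.closure_subset_iff.2 (fun ρ hρ => bilin_root_self hB hΔ.diag hρ)
      (mem_closure_iff_clusterPt.2 hx.clusterPt)
  have hev := eventually_roots_eq hB hΔ (hxB ▸ zero_lt_one)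
  rw [nhds_prod_eq] at hev
  obtain ⟨U, hU, hUeq⟩ := mem_prod_same_iff.1 hev
  have hsub : (U ∩ roots B (range b)).Subsingleton := fun ρ hρ σ hσ =>
    hUeq (mk_mem_prod hρ.1 hσ.1) hρ.2 hσ.2
  exact Set.Infinite.of_accPt (hx.nhds_inter hU) hsub.finite

theorem finite_roots_inter [Finite ι] (hB : B.IsSymm) (hΔ : IsSimpleSystem B (range b))
    {K : Set V} (hK : IsCompact K) : (roots B (range b) ∩ K).Finite := by
  by_contra hinf
  obtain ⟨x, -, hx⟩ := Set.Infinite.exists_accPt_of_subset_isCompact hinf hK inter_subset_right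
  exact not_accPt_roots hB hΔ x (hx.mono (Filter.principal_mono.2 inter_subset_left))

end Discreteness

section LimitsOfPositiveRoots

open Filter

variable {V ι : Type*}

/-- The filter of the cofinite sets of positive roots: limits of normalized positive roots along
it are the limits of the sequences `normalize b (ρ n)` with pairwise distinct `ρ n`. -/
def posRootsCofinite [AddCommGroup V] [Module ℝ V] (B : LinearMap.BilinForm ℝ V)
    (b : Module.Basis ι ℝ V) : Filter V :=
  cofinite ⊓ 𝓟 (posRoots B (range b))

theorem eventually_mem_posRoots [AddCommGroup V] [Module ℝ V] {b : Module.Basis ι ℝ V}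
    {B : LinearMap.BilinForm ℝ V} {F : Filter V} (hF : F ≤ posRootsCofinite B b) :
    ∀ᶠ ρ in F, ρ ∈ posRoots B (range b) :=
  hF (mem_inf_of_right (mem_principal_self _))

variable [Fintype ι] [NormedAddCommGroup V] [NormedSpace ℝ V] {b : Module.Basis ι ℝ V}
  {B : LinearMap.BilinForm ℝ V}

theorem tendsto_coordSum_posRootsCofinite (hB : B.IsSymm) (hΔ : IsSimpleSystem B (range b)) :
    Tendsto (coordSum b) (posRootsCofinite B b) atTop := by
  refine tendsto_atTop.2 fun C => ?_
  rw [posRootsCofinite, eventually_inf_principal, eventually_cofinite]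
  refine (finite_roots_inter hB hΔ (isCompact_repr_nonneg_coordSum_le b C)).subset fun ρ hρ => ?_
  obtain ⟨hρ, hC⟩ := Classical.not_imp.1 hρ
  obtain ⟨hρ, hnonneg⟩ := mem_posRoots_iff.1 hρ
  exact ⟨hρ, hnonneg, (not_le.1 hC).le⟩

section

variable {F : Filter V} [F.NeBot] {η : V}

theorem bilin_self_eq_zero_of_tendsto (hB : B.IsSymm) (hΔ : IsSimpleSystem B (range b))
    (hF : F ≤ posRootsCofinite B b) (hη : Tendsto (normalize b) F (𝓝 η)) : B η η = 0 := by
  have : FiniteDimensional ℝ V := b.finiteDimensional_of_finite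
  have hlim : Tendsto (fun ρ => B (normalize b ρ) (normalize b ρ)) F (𝓝 (B η η)) :=
    ((continuous_bilin B).tendsto (η, η)).comp (hη.prodMk_nhds hη)
  have hzero : Tendsto (fun ρ => (coordSum b ρ)⁻¹ ^ 2) F (𝓝 (0 ^ 2)) :=
    (tendsto_inv_atTop_zero.comp ((tendsto_coordSum_posRootsCofinite hB hΔ).mono_left hF)).pow 2
  rw [zero_pow two_ne_zero] at hzero
  refine tendsto_nhds_unique (hlim.congr' ?_) hzero
  filter_upwards [eventually_mem_posRoots hF] with ρ hρ
  exact bilin_normalize_root hB hΔ hρ.1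

theorem coordSum_eq_one_of_tendsto (hB : B.IsSymm) (hΔ : IsSimpleSystem B (range b))
    (hF : F ≤ posRootsCofinite B b) (hη : Tendsto (normalize b) F (𝓝 η)) : coordSum b η = 1 := by
  refine tendsto_nhds_unique (((continuous_coordSum b).tendsto η).comp hη)
    (tendsto_const_nhds.congr' ?_)
  filter_upwards [eventually_mem_posRoots hF] with ρ hρ
  exact (coordSum_normalize (coordSum_root_ne_zero hB hΔ hρ.1)).symm

theorem repr_nonneg_of_tendsto (hF : F ≤ posRootsCofinite B b)
    (hη : Tendsto (normalize b) F (𝓝 η)) : 0 ≤ b.repr η := by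
  refine (isClosed_repr_nonneg b).mem_of_tendsto hη ?_
  filter_upwards [eventually_mem_posRoots hF] with ρ hρ
  exact repr_normalize_nonneg (mem_posRoots_iff.1 hρ).2

end

theorem exists_tendsto_normalize_of_infinite (hB : B.IsSymm) (hΔ : IsSimpleSystem B (range b))
    {T : Set V} (hT : T.Infinite) (hTsub : T ⊆ posRoots B (range b)) :
    ∃ (F : Filter V) (η : V), F.NeBot ∧ F ≤ cofinite ⊓ 𝓟 T ∧ Tendsto (normalize b) F (𝓝 η) := by
  have : (cofinite ⊓ 𝓟 T).NeBot := cofinite_inf_principal_neBot_iff.2 hT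
  have hmem : ∀ ρ ∈ T, normalize b ρ ∈ {v | 0 ≤ b.repr v ∧ coordSum b v ≤ 1} := fun ρ hρ =>
    have ⟨hρ, hnonneg⟩ := mem_posRoots_iff.1 (hTsub hρ)
    ⟨repr_normalize_nonneg hnonneg, (coordSum_normalize (coordSum_root_ne_zero hB hΔ hρ)).le⟩
  obtain ⟨η, -, hη⟩ := (isCompact_repr_nonneg_coordSum_le b 1).exists_mapClusterPt
    (tendsto_principal_principal.2 hmem |>.mono_left (inf_le_right (a := cofinite)))
  obtain ⟨F, hF, hFη⟩ := mapClusterPt_iff_ultrafilter.1 hη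
  exact ⟨F, η, F.neBot, hF, hFη⟩

theorem exists_tendsto_normalize_of_mem_limitRoots (hB : B.IsSymm)
    (hΔ : IsSimpleSystem B (range b)) {η : V} (hη : η ∈ limitRoots B b) :
    ∃ F : Filter V, F.NeBot ∧ F ≤ posRootsCofinite B b ∧ Tendsto (normalize b) F (𝓝 η) := by
  suffices hcluster : MapClusterPt η (posRootsCofinite B b) (normalize b) by
    obtain ⟨F, hF, hFη⟩ := mapClusterPt_iff_ultrafilter.1 hcluster
    exact ⟨F, F.neBot, hF, hFη⟩
  refine mapClusterPt_iff_frequently.2 fun U hU => ?_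
  rw [posRootsCofinite, frequently_inf_principal, frequently_cofinite_iff_infinite]
  refine Set.Infinite.of_image (normalize b)
    ((Set.Infinite.of_accPt (AccPt.nhds_inter hη hU)).mono ?_)
  rintro _ ⟨hρU, ρ, hρ, rfl⟩
  obtain hρ | hρ := mem_posRoots_or_neg_mem_posRoots hB hΔ hρ
  · exact ⟨ρ, ⟨hρ, hρU⟩, rfl⟩
  · exact ⟨-ρ, ⟨hρ, (normalize_neg (b := b) ρ).symm ▸ hρU⟩, normalize_neg ρ⟩

end LimitsOfPositiveRoots

section DihedralLimitRoots

open Filter Polynomial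

theorem eval_chebyshev_U_succ_eq {a t : ℝ} (ht : t ≠ 0) (hta : t + t⁻¹ = 2 * a) (n : ℕ) :
    (Chebyshev.U ℝ (n + 1 : ℕ)).eval a = t * (Chebyshev.U ℝ n).eval a + t⁻¹ ^ (n + 1) := by
  induction n with
  | zero => simp [← hta]
  | succ n ih =>
    have hrec : (Chebyshev.U ℝ (n + 1 + 1 : ℕ)).eval a =
        2 * a * (Chebyshev.U ℝ (n + 1 : ℕ)).eval a - (Chebyshev.U ℝ n).eval a := by
      push_cast
      rw [add_assoc, one_add_one_eq_two, Chebyshev.U_add_two]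
      simp
    rw [hrec, ← hta, pow_succ]
    linear_combination t⁻¹ * ih + (Chebyshev.U ℝ n).eval a * inv_mul_cancel₀ ht

theorem one_le_of_add_inv_eq {a t : ℝ} (ht : 0 < t) (hta : t + t⁻¹ = 2 * a) : 1 ≤ a := by
  have hinv : t * t⁻¹ = 1 := mul_inv_cancel₀ ht.ne'
  nlinarith [sq_nonneg (t - t⁻¹), inv_pos.2 ht]

theorem tendsto_eval_chebyshev_U_succ_div {a t : ℝ} (ht : 1 ≤ t) (hta : t + t⁻¹ = 2 * a) :
    Tendsto (fun n : ℕ => (Chebyshev.U ℝ (n + 1 : ℕ)).eval a / (Chebyshev.U ℝ n).eval a) atTop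
      (𝓝 t) := by
  have htpos : 0 < t := zero_lt_one.trans_le ht
  have ha := one_le_of_add_inv_eq htpos hta
  have hU (n : ℕ) : (n : ℝ) + 1 ≤ (Chebyshev.U ℝ n).eval a := add_one_le_eval_chebyshev_U ha n
  have hUpos (n : ℕ) : 0 < (Chebyshev.U ℝ n).eval a := n.cast_add_one_pos.trans_le (hU n)
  have herror : Tendsto (fun n : ℕ => t⁻¹ ^ (n + 1) / (Chebyshev.U ℝ n).eval a) atTop (𝓝 0) := by
    refine squeeze_zero (fun n => div_nonneg (by positivity) (hUpos n).le) (fun n => ?_)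
      tendsto_one_div_add_atTop_nhds_zero_nat
    exact div_le_div₀ zero_le_one (pow_le_one₀ (by positivity) (inv_le_one_of_one_le₀ ht))
      n.cast_add_one_pos (hU n)
  have hsum := herror.const_add t
  rw [add_zero] at hsum
  refine hsum.congr fun n => ?_
  rw [eval_chebyshev_U_succ_eq htpos.ne' hta, add_div, mul_div_cancel_right₀ _ (hUpos n).ne']

section

variable {V : Type*} [AddCommGroup V] [Module ℝ V] {B : LinearMap.BilinForm ℝ V}

theorem bilin_smul_add_smul_self (hB : B.IsSymm) {σ τ : V} (hσ : B σ σ = 1) (hτ : B τ τ = 1)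
    (p q : ℝ) :
    B (p • σ + q • τ) (p • σ + q • τ) = p * p + q * q + 2 * p * q * B σ τ := by
  simp only [map_add, map_smul, LinearMap.add_apply, LinearMap.smul_apply, smul_eq_mul, hσ, hτ,
    hB.eq τ σ]
  ring

theorem exists_root_abs_smul_eq (hB : B.IsSymm) {Δ : Set V} (hunit : ∀ α ∈ Δ, B α α = 1) {σ : V}
    (hσ : σ ∈ roots B Δ) (p : ℝ) : ∃ σ' ∈ roots B Δ, |p| • σ' = p • σ := by
  obtain hp | hp := abs_choice p
  · exact ⟨σ, hσ, by rw [hp]⟩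
  · exact ⟨-σ, neg_mem_roots hB hunit hσ, by rw [hp, neg_smul_neg]⟩

end

variable {V ι : Type*} [Fintype ι] [NormedAddCommGroup V] [NormedSpace ℝ V]
  {b : Module.Basis ι ℝ V} {B : LinearMap.BilinForm ℝ V}

theorem mem_limitRoots_of_tendsto (hB : B.IsSymm) (hΔ : IsSimpleSystem B (range b)) {u : ℕ → V}
    (hu : ∀ n, u n ∈ roots B (range b)) {η : V} (hη : B η η = 0)
    (hlim : Tendsto (fun n => normalize b (u n)) atTop (𝓝 η)) : η ∈ limitRoots B b := by
  refine accPt_iff_frequently.2 <| hlim.frequently <| .of_forall fun n =>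
    ⟨fun heq => ?_, u n, hu n, rfl⟩
  have hsq := bilin_normalize_root hB hΔ (hu n)
  rw [heq, hη] at hsq
  exact pow_ne_zero 2 (inv_ne_zero (coordSum_root_ne_zero hB hΔ (hu n))) hsq.symm

theorem tendsto_normalize_dihedralVec {t : ℝ} (ht : 1 ≤ t) {σ τ : V}
    (hta : t + t⁻¹ = 2 * -B σ τ) (hsum : coordSum b (t • σ + τ) ≠ 0) :
    Tendsto (fun n : ℕ => normalize b (dihedralVec B σ τ (n + 1 : ℕ))) atTop
      (𝓝 (normalize b (t • σ + τ))) := by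
  have ha := one_le_of_add_inv_eq (zero_lt_one.trans_le ht) hta
  refine ((continuousAt_normalize hsum).tendsto.comp
    (((tendsto_eval_chebyshev_U_succ_div ht hta).smul_const σ).add_const τ)).congr fun n => ?_
  have hUpos : 0 < (Chebyshev.U ℝ n).eval (-B σ τ) :=
    n.cast_add_one_pos.trans_le (add_one_le_eval_chebyshev_U ha n)
  rw [Function.comp_apply, ← normalize_smul hUpos.ne', smul_add, smul_smul,
    mul_div_cancel₀ _ hUpos.ne', dihedralVec, Nat.cast_succ, add_sub_cancel_right]

theorem smul_add_smul_mem_limitRoots_of_le (hB : B.IsSymm) (hΔ : IsSimpleSystem B (range b))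
    {σ τ : V} (hσ : σ ∈ roots B (range b)) (hτ : τ ∈ roots B (range b)) {p q : ℝ} (hq : 0 < q)
    (hqp : q ≤ p) (h : p • σ + q • τ ∈ normIsotropicCone B b) :
    p • σ + q • τ ∈ limitRoots B b := by
  obtain ⟨hiso : B _ _ = 0, hsum : coordSum b _ = 1⟩ := h
  have hfactor : p • σ + q • τ = q • ((p / q) • σ + τ) := by
    rw [smul_add, smul_smul, mul_div_cancel₀ _ hq.ne']
  have hratio : p / q + (p / q)⁻¹ = 2 * -B σ τ := by
    rw [bilin_smul_add_smul_self hB (bilin_root_self hB hΔ.diag hσ)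
      (bilin_root_self hB hΔ.diag hτ)] at hiso
    have hp := hq.trans_le hqp
    field_simp
    linarith
  have hsum' : coordSum b ((p / q) • σ + τ) ≠ 0 := by
    rw [hfactor, coordSum_smul] at hsum
    exact right_ne_zero_of_mul_eq_one hsum
  refine mem_limitRoots_of_tendsto hB hΔ (fun n => dihedralVec_mem_roots hB hΔ.diag (n + 1) hσ hτ)
    hiso ?_
  rw [← normalize_eq_self hsum, hfactor, normalize_smul hq.ne']
  exact tendsto_normalize_dihedralVec ((one_le_div hq).2 hqp) hratio hsum'

theorem smul_add_smul_mem_limitRoots_of_pos (hB : B.IsSymm) (hΔ : IsSimpleSystem B (range b))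
    {σ τ : V} (hσ : σ ∈ roots B (range b)) (hτ : τ ∈ roots B (range b)) {p q : ℝ} (hp : 0 < p)
    (hq : 0 < q) (h : p • σ + q • τ ∈ normIsotropicCone B b) :
    p • σ + q • τ ∈ limitRoots B b := by
  obtain hqp | hpq := le_total q p
  · exact smul_add_smul_mem_limitRoots_of_le hB hΔ hσ hτ hq hqp h
  · rw [add_comm] at h ⊢
    exact smul_add_smul_mem_limitRoots_of_le hB hΔ hτ hσ hp hpq h

theorem smul_add_smul_mem_limitRoots (hB : B.IsSymm) (hΔ : IsSimpleSystem B (range b))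
    {σ τ : V} (hσ : σ ∈ roots B (range b)) (hτ : τ ∈ roots B (range b)) {p q : ℝ}
    (h : p • σ + q • τ ∈ normIsotropicCone B b) : p • σ + q • τ ∈ limitRoots B b := by
  have hpq : p ≠ 0 ∧ q ≠ 0 := by
    obtain ⟨hiso : B _ _ = 0, hsum : coordSum b _ = 1⟩ := h
    rw [bilin_smul_add_smul_self hB (bilin_root_self hB hΔ.diag hσ)
      (bilin_root_self hB hΔ.diag hτ)] at hiso
    by_contra! hzero
    have hp : p = 0 := by
      by_contra hp
      simp [hzero hp, hp] at hiso
    have hq : q = 0 := by simpa [hp] using hiso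
    simp [hp, hq, coordSum] at hsum
  obtain ⟨σ', hσ', hpσ⟩ := exists_root_abs_smul_eq hB hΔ.diag hσ p
  obtain ⟨τ', hτ', hqτ⟩ := exists_root_abs_smul_eq hB hΔ.diag hτ q
  rw [← hpσ, ← hqτ] at h ⊢
  exact smul_add_smul_mem_limitRoots_of_pos hB hΔ hσ' hτ' (abs_pos.2 hpq.1) (abs_pos.2 hpq.2) h

theorem simpleDihedralLimitRoots_subset (hB : B.IsSymm) (hΔ : IsSimpleSystem B (range b)) :
    simpleDihedralLimitRoots B b ⊆ limitRoots B b := by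
  simp only [simpleDihedralLimitRoots, iUnion_subset_iff]
  rintro α hα ρ hρ x ⟨hline, hx⟩
  obtain ⟨r, rfl⟩ := mem_affineSpan_pair_iff_exists_lineMap_eq.1 hline
  rw [AffineMap.lineMap_apply_module, normalize, smul_smul] at hx ⊢
  exact smul_add_smul_mem_limitRoots hB hΔ (subset_roots hα) hρ.1 hx

end DihedralLimitRoots

section DensityOfDihedralLimitRoots

open Filter

theorem eventually_exists_eq_zero_of_deriv_pos {X : Type*} [TopologicalSpace X] {g : X → ℝ → ℝ}
    (hgX : ∀ t, Continuous fun x => g x t) (hgt : ∀ x, Continuous (g x)) {x₀ : X} {t₀ : ℝ}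
    (hzero : g x₀ t₀ = 0) (hderiv : 0 < deriv (g x₀) t₀) {N : Set ℝ} (hN : N ∈ 𝓝 t₀) :
    ∀ᶠ x in 𝓝 x₀, ∃ t ∈ N, g x t = 0 := by
  have hsign := eventually_nhdsWithin_sign_eq_of_deriv_pos hderiv hzero
  obtain ⟨ε, hε, hball⟩ := Metric.nhds_basis_closedBall.mem_iff.1 (inter_mem hsign hN)
  rw [Real.closedBall_eq_Icc] at hball
  have hleft : g x₀ (t₀ - ε) < 0 := by
    have h := (hball (left_mem_Icc.2 (by linarith))).1
    rwa [mem_ofPred_eq, sub_sub_cancel_left, sign_neg (neg_neg_of_pos hε), sign_eq_neg_one_iff] at h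
  have hright : 0 < g x₀ (t₀ + ε) := by
    have h := (hball (right_mem_Icc.2 (by linarith))).1
    rwa [mem_ofPred_eq, add_sub_cancel_left, sign_pos hε, sign_eq_one_iff] at h
  filter_upwards [(hgX (t₀ - ε)).continuousAt.eventually (gt_mem_nhds hleft),
    (hgX (t₀ + ε)).continuousAt.eventually (lt_mem_nhds hright)] with x hxleft hxright
  obtain ⟨t, ht, hxt⟩ := intermediate_value_Icc (by linarith) (hgt x).continuousOn
    (⟨hxleft.le, hxright.le⟩ : (0 : ℝ) ∈ Icc _ _)
  exact ⟨t, (hball ht).2, hxt⟩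

theorem eventually_exists_eq_zero_of_deriv_ne_zero {X : Type*} [TopologicalSpace X]
    {g : X → ℝ → ℝ} (hgX : ∀ t, Continuous fun x => g x t) (hgt : ∀ x, Continuous (g x)) {x₀ : X}
    {t₀ : ℝ} (hzero : g x₀ t₀ = 0) (hderiv : deriv (g x₀) t₀ ≠ 0) {N : Set ℝ} (hN : N ∈ 𝓝 t₀) :
    ∀ᶠ x in 𝓝 x₀, ∃ t ∈ N, g x t = 0 := by
  obtain hneg | hpos := hderiv.lt_or_gt
  · have hderiv' : 0 < deriv (-g x₀) t₀ := by
      rw [deriv.neg]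
      exact neg_pos.2 hneg
    simpa only [Pi.neg_apply, neg_eq_zero] using
      eventually_exists_eq_zero_of_deriv_pos (g := -g) (fun t => (hgX t).neg)
        (fun x => (hgt x).neg) (neg_eq_zero.2 hzero) hderiv' hN
  · exact eventually_exists_eq_zero_of_deriv_pos hgX hgt hzero hpos hN

theorem bilin_lineMap_self {V : Type*} [AddCommGroup V] [Module ℝ V] {B : LinearMap.BilinForm ℝ V}
    (hB : B.IsSymm) (x y : V) (t : ℝ) :
    B (AffineMap.lineMap x y t) (AffineMap.lineMap x y t) =
      (1 - t) ^ 2 * B x x + t ^ 2 * B y y + 2 * t * (1 - t) * B y x := by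
  simp only [AffineMap.lineMap_apply_module, map_add, map_smul, LinearMap.add_apply,
    LinearMap.smul_apply, smul_eq_mul, hB.eq x y]
  ring

theorem deriv_bilin_lineMap_zero {V : Type*} [AddCommGroup V] [Module ℝ V]
    {B : LinearMap.BilinForm ℝ V} (hB : B.IsSymm) {x : V} (hx : B x x = 0) (y : V) :
    deriv (fun t : ℝ => B (AffineMap.lineMap x y t) (AffineMap.lineMap x y t)) 0 =
      2 * B y x := by
  simp only [bilin_lineMap_self hB, hx, mul_zero, zero_add]
  have hid := hasDerivAt_id (0 : ℝ)
  have h : HasDerivAt (fun t : ℝ => t ^ 2 * B y y + 2 * t * (1 - t) * B y x) _ 0 :=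
    ((hid.pow 2).mul_const (B y y)).add
      (((hid.const_mul 2).mul (hid.const_sub 1)).mul_const (B y x))
  simpa using h.deriv

theorem coordSum_lineMap {V ι : Type*} [AddCommGroup V] [Module ℝ V] [Fintype ι]
    (b : Module.Basis ι ℝ V) (x y : V) (t : ℝ) :
    coordSum b (AffineMap.lineMap x y t) = AffineMap.lineMap (coordSum b x) (coordSum b y) t := by
  simp only [AffineMap.lineMap_apply_module, coordSum_add, coordSum_smul, smul_eq_mul]

variable {V ι : Type*} [Fintype ι] [NormedAddCommGroup V] [NormedSpace ℝ V]
  {b : Module.Basis ι ℝ V} {B : LinearMap.BilinForm ℝ V}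

theorem eventually_exists_bilin_lineMap_eq_zero [FiniteDimensional ℝ V] (hB : B.IsSymm) {η α : V}
    (hη : B η η = 0) (hαη : B α η ≠ 0) {N : Set ℝ} (hN : N ∈ 𝓝 0) :
    ∀ᶠ x in 𝓝 η, ∃ t ∈ N, B (AffineMap.lineMap x α t) (AffineMap.lineMap x α t) = 0 := by
  have hcont : Continuous fun p : V × ℝ =>
      B (AffineMap.lineMap p.1 α p.2) (AffineMap.lineMap p.1 α p.2) := by
    have hline : Continuous fun p : V × ℝ => AffineMap.lineMap p.1 α p.2 := by
      simp only [AffineMap.lineMap_apply_module]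
      fun_prop
    exact (continuous_bilin B).comp (hline.prodMk hline)
  refine eventually_exists_eq_zero_of_deriv_ne_zero
    (g := fun x t => B (AffineMap.lineMap x α t) (AffineMap.lineMap x α t))
    (fun t => hcont.along_fst) (fun x => hcont.along_snd) ?_ ?_ hN
  · rwa [AffineMap.lineMap_apply_zero]
  · rw [deriv_bilin_lineMap_zero hB hη]
    exact mul_ne_zero two_ne_zero hαη

theorem mem_closure_simpleDihedralLimitRoots_of_bilin_ne_zero (hB : B.IsSymm)
    (hΔ : IsSimpleSystem B (range b)) {F : Filter V} [F.NeBot] (hF : F ≤ posRootsCofinite B b)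
    {η : V} (hη : Tendsto (normalize b) F (𝓝 η)) {i : ι} (hi : B (b i) η ≠ 0) :
    η ∈ closure (simpleDihedralLimitRoots B b) := by
  have : FiniteDimensional ℝ V := b.finiteDimensional_of_finite
  refine mem_closure_iff_nhds.2 fun U hU => ?_
  have hline : Tendsto (fun p : V × ℝ => AffineMap.lineMap p.1 (b i) p.2) (𝓝 η ×ˢ 𝓝 0) (𝓝 η) := by
    rw [← nhds_prod_eq]
    refine Continuous.tendsto' ?_ _ _ (AffineMap.lineMap_apply_zero _ _)
    simp only [AffineMap.lineMap_apply_module]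
    fun_prop
  obtain ⟨M, hM, N, hN, hMN⟩ := mem_prod_iff.1 (hline hU)
  obtain ⟨ρ, hρ, hρM, t, htN, ht⟩ := ((eventually_mem_posRoots hF).and <|
    (hη.eventually hM).and <| hη.eventually <| eventually_exists_bilin_lineMap_eq_zero hB
      (bilin_self_eq_zero_of_tendsto hB hΔ hF hη) hi hN).exists
  refine ⟨AffineMap.lineMap (normalize b ρ) (b i) t, hMN (mk_mem_prod hρM htN), ?_⟩
  refine mem_biUnion (mem_range_self i) (mem_biUnion hρ ⟨?_, ht, ?_⟩)
  · rw [pair_comm]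
    exact AffineMap.lineMap_mem_affineSpan_pair t _ _
  · rw [affHyperplane, mem_ofPred_eq, coordSum_lineMap, coordSum_basis,
      coordSum_normalize (coordSum_root_ne_zero hB hΔ hρ.1), AffineMap.lineMap_same_apply]

end DensityOfDihedralLimitRoots

section StandardSubspaces

variable {V ι : Type*} [AddCommGroup V] [Module ℝ V] {B : LinearMap.BilinForm ℝ V}
  {b : Module.Basis ι ℝ V} {S : Set ι}

/-- The span of the simple roots `b i` with `i ∈ S`, on which the standard parabolic subgroup of
type `S` acts. -/
def standardSubspace (b : Module.Basis ι ℝ V) (S : Set ι) : Submodule ℝ V :=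
  Submodule.span ℝ (b '' S)

theorem basis_mem_standardSubspace {i : ι} (hi : i ∈ S) : b i ∈ standardSubspace b S :=
  Submodule.subset_span (mem_image_of_mem b hi)

theorem mem_standardSubspace_iff {v : V} :
    v ∈ standardSubspace b S ↔ ∀ i ∉ S, b.repr v i = 0 := by
  rw [standardSubspace, Module.Basis.mem_span_image]
  refine forall_congr' fun i => ?_
  rw [Finset.mem_coe, Finsupp.mem_support_iff, not_imp_comm]

theorem bilin_eq_zero_of_mem_standardSubspace {u v : V} (h : ∀ j ∈ S, B u (b j) = 0)
    (hv : v ∈ standardSubspace b S) : B u v = 0 :=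
  Submodule.span_le (p := (B u).ker).2 (image_subset_iff.2 h) hv

theorem bilin_eq_zero_of_forall_basis {u : V} (h : ∀ j, B u (b j) = 0) (v : V) : B u v = 0 :=
  LinearMap.congr_fun (b.ext (f₁ := B u) (f₂ := 0) h) v

section Orthogonal

variable (hB : B.IsSymm) (hS : ∀ i ∈ S, ∀ j ∉ S, B (b i) (b j) = 0)
include hB hS

theorem apply_mem_standardSubspace {w : V ≃ₗ[ℝ] V} (hw : w ∈ weylGroup B (range b)) {v : V}
    (hv : v ∈ standardSubspace b S) : w v ∈ standardSubspace b S := by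
  induction hw using weylGroup_induction with
  | one => exact hv
  | reflection_mul α hα hα' w _ hwv =>
    obtain ⟨i, rfl⟩ := hα
    rw [LinearEquiv.mul_apply, reflection_apply, reflectionMap_apply]
    by_cases hi : i ∈ S
    · exact sub_mem hwv (Submodule.smul_mem _ _ (basis_mem_standardSubspace hi))
    · have horth : B (b i) (w v) = 0 :=
        bilin_eq_zero_of_mem_standardSubspace (fun j hj => hB.isRefl.eq_zero (hS j hj i hi)) hwv
      rwa [horth, zero_div, mul_zero, zero_smul, sub_zero]

theorem root_mem_standardSubspace_or {ρ : V} (hρ : ρ ∈ roots B (range b)) :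
    ρ ∈ standardSubspace b S ∨ ρ ∈ standardSubspace b Sᶜ := by
  obtain ⟨w, hw, _, ⟨i, rfl⟩, rfl⟩ := hρ
  by_cases hi : i ∈ S
  · exact .inl (apply_mem_standardSubspace hB hS hw (basis_mem_standardSubspace hi))
  · refine .inr (apply_mem_standardSubspace hB (fun j hj k hk => ?_) hw
      (basis_mem_standardSubspace hi))
    exact hB.isRefl.eq_zero (hS k (not_not.1 hk) j hj)

end Orthogonal

end StandardSubspaces

section FiniteAnisotropic

open Filter

variable {V ι : Type*} [NormedAddCommGroup V] [NormedSpace ℝ V] {B : LinearMap.BilinForm ℝ V}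
  {b : Module.Basis ι ℝ V}

theorem exists_isotropic_of_infinite [Fintype ι] (hB : B.IsSymm) (hΔ : IsSimpleSystem B (range b))
    {T C : Set V} (hT : T.Infinite) (hTsub : T ⊆ posRoots B (range b)) (hC : IsClosed C)
    (hTC : MapsTo (normalize b) T C) : ∃ η ∈ C, B η η = 0 ∧ coordSum b η = 1 := by
  obtain ⟨F, η, _, hFT, hη⟩ := exists_tendsto_normalize_of_infinite hB hΔ hT hTsub
  have hF : F ≤ posRootsCofinite B b :=
    hFT.trans (inf_le_inf_left _ (principal_mono.2 hTsub))
  have hmem : ∀ᶠ ρ in F, ρ ∈ T := hFT (mem_inf_of_right (mem_principal_self T))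
  exact ⟨η, hC.mem_of_tendsto hη (hmem.mono hTC), bilin_self_eq_zero_of_tendsto hB hΔ hF hη,
    coordSum_eq_one_of_tendsto hB hΔ hF hη⟩

theorem finite_roots_inter_of_anisotropic [Finite ι] (hB : B.IsSymm)
    (hΔ : IsSimpleSystem B (range b)) {U : Submodule ℝ V} (hU : ∀ v ∈ U, B v v = 0 → v = 0) :
    (roots B (range b) ∩ U).Finite := by
  cases nonempty_fintype ι
  have : FiniteDimensional ℝ V := b.finiteDimensional_of_finite
  have hfin : (posRoots B (range b) ∩ U).Finite := by
    by_contra hinf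
    obtain ⟨η, hηU, hηη, hη⟩ := exists_isotropic_of_infinite hB hΔ hinf inter_subset_left
      U.closed_of_finiteDimensional fun ρ hρ => U.smul_mem _ hρ.2
    rw [hU η hηU hηη, ← zero_smul ℝ (0 : V), coordSum_smul, zero_mul] at hη
    exact zero_ne_one hη
  refine (hfin.union (hfin.image Neg.neg)).subset fun ρ ⟨hρ, hρU⟩ => ?_
  obtain hpos | hneg := mem_posRoots_or_neg_mem_posRoots hB hΔ hρ
  · exact .inl ⟨hpos, hρU⟩
  · exact .inr ⟨-ρ, ⟨hneg, U.neg_mem hρU⟩, neg_neg ρ⟩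

end FiniteAnisotropic

theorem sum_sum_mul_sub_sq {ι R : Type*} [Fintype ι] [CommRing R] {M : ι → ι → R}
    (hrow : ∀ i, ∑ j, M i j = 0) (hcol : ∀ j, ∑ i, M i j = 0) (x : ι → R) :
    ∑ i, ∑ j, M i j * (x i - x j) ^ 2 = -2 * ∑ i, ∑ j, M i j * (x i * x j) := by
  have hleft : ∑ i, ∑ j, M i j * x i ^ 2 = 0 :=
    Finset.sum_eq_zero fun i _ => by rw [← Finset.sum_mul, hrow, zero_mul]
  have hright : ∑ i, ∑ j, M i j * x j ^ 2 = 0 := by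
    rw [Finset.sum_comm]
    exact Finset.sum_eq_zero fun j _ => by rw [← Finset.sum_mul, hcol, zero_mul]
  calc ∑ i, ∑ j, M i j * (x i - x j) ^ 2
      = ∑ i, ∑ j, M i j * x i ^ 2 + ∑ i, ∑ j, M i j * x j ^ 2 +
          -2 * ∑ i, ∑ j, M i j * (x i * x j) := by
        simp only [Finset.mul_sum, ← Finset.sum_add_distrib]
        exact Finset.sum_congr rfl fun i _ => Finset.sum_congr rfl fun j _ => by ring
    _ = -2 * ∑ i, ∑ j, M i j * (x i * x j) := by rw [hleft, hright, add_zero, zero_add]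

section Radical

variable {V ι : Type*} [AddCommGroup V] [Module ℝ V] {B : LinearMap.BilinForm ℝ V}
  {b : Module.Basis ι ℝ V}

theorem IsSimpleSystem.bilin_nonpos {Δ : Set V} (hΔ : IsSimpleSystem B Δ) {α β : V} (hα : α ∈ Δ)
    (hβ : β ∈ Δ) (hne : α ≠ β) : B α β ≤ 0 := by
  obtain h | ⟨k, hk, h⟩ := hΔ.offDiag α hα β hβ hne
  · linarith
  · have hk' : (2 : ℝ) ≤ k := mod_cast hk
    have hcos : 0 ≤ Real.cos (Real.pi / k) :=
      Real.cos_nonneg_of_neg_pi_div_two_le_of_le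
        (by linarith [Real.pi_pos, show (0 : ℝ) ≤ Real.pi / k by positivity])
        (div_le_div_of_nonneg_left Real.pi_pos.le two_pos hk')
    linarith

theorem bilin_eq_one_or_eq_neg_one_of_mem_span (hB : B.IsSymm) {ρ σ η : V} (hρ : B ρ ρ = 1)
    (hσ : B σ σ = 1) (hη : η ≠ 0) (hrad : ∀ v, B v η = 0) (hspan : η ∈ Submodule.span ℝ {ρ, σ}) :
    B ρ σ = 1 ∨ B ρ σ = -1 := by
  obtain ⟨p, q, rfl⟩ := Submodule.mem_span_pair.1 hspan
  have hρη : p + q * B ρ σ = 0 := by simpa [hρ] using hrad ρ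
  have hση : p * B ρ σ + q = 0 := by simpa [hσ, hB.eq σ ρ] using hrad σ
  have hmul : q * (1 - B ρ σ * B ρ σ) = 0 := by linear_combination hση - B ρ σ * hρη
  obtain rfl | hsq := mul_eq_zero.1 hmul
  · obtain rfl : p = 0 := by linarith
    exact absurd (by rw [zero_smul, zero_smul, add_zero]) hη
  · exact mul_self_eq_one_iff.1 (sub_eq_zero.1 hsq).symm

theorem dual_apply_eq_sum_repr [Fintype ι] (b : Module.Basis ι ℝ V) (f : Module.Dual ℝ V) (v : V) :
    f v = ∑ i, b.repr v i * f (b i) := by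
  conv_lhs => rw [← b.sum_repr v]
  simp only [map_sum, map_smul, smul_eq_mul]

theorem bilin_eq_sum_sum_repr [Fintype ι] (b : Module.Basis ι ℝ V) (u v : V) :
    B u v = ∑ i, ∑ j, b.repr u i * b.repr v j * B (b i) (b j) := by
  rw [← LinearMap.flip_apply, dual_apply_eq_sum_repr b]
  refine Finset.sum_congr rfl fun i _ => ?_
  rw [LinearMap.flip_apply, dual_apply_eq_sum_repr b, Finset.mul_sum]
  exact Finset.sum_congr rfl fun j _ => (mul_assoc _ _ _).symm

variable {η v : V}

theorem bilin_eq_zero_of_mem_support_of_notMem [Finite ι] (hB : B.IsSymm)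
    (hΔ : IsSimpleSystem B (range b)) (hnonneg : 0 ≤ b.repr η) (hrad : ∀ v, B v η = 0) :
    ∀ i ∈ Function.support (b.repr η), ∀ j ∉ Function.support (b.repr η),
      B (b i) (b j) = 0 := by
  cases nonempty_fintype ι
  intro i hi j hj
  have hterm : ∀ k ∈ Finset.univ, b.repr η k * B (b j) (b k) ≤ 0 := fun k _ => by
    obtain rfl | hjk := eq_or_ne j k
    · rw [Function.notMem_support.1 hj, zero_mul]
    · exact mul_nonpos_of_nonneg_of_nonpos (hnonneg k)
        (hΔ.bilin_nonpos (mem_range_self j) (mem_range_self k) (b.injective.ne hjk))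
  have hsum := (dual_apply_eq_sum_repr b (B (b j)) η).symm.trans (hrad (b j))
  have hij := (Finset.sum_eq_zero_iff_of_nonpos hterm).1 hsum i (Finset.mem_univ i)
  exact hB.isRefl.eq_zero ((mul_eq_zero.1 hij).resolve_left hi)

theorem neg_two_mul_bilin_self_eq_sum_sum_sq [Fintype ι] (hB : B.IsSymm)
    (hrad : ∀ v, B v η = 0) (hv : v ∈ standardSubspace b (Function.support (b.repr η))) :
    -2 * B v v = ∑ i, ∑ j, b.repr η i * b.repr η j * B (b i) (b j) *
      (b.repr v i / b.repr η i - b.repr v j / b.repr η j) ^ 2 := by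
  have hrow : ∀ i, ∑ j, b.repr η i * b.repr η j * B (b i) (b j) = 0 := fun i => by
    simp only [mul_assoc]
    rw [← Finset.mul_sum, ← dual_apply_eq_sum_repr b, hrad, mul_zero]
  have hcol : ∀ j, ∑ i, b.repr η i * b.repr η j * B (b i) (b j) = 0 := fun j => by
    simpa only [mul_comm (b.repr η j), hB.eq (b j)] using hrow j
  have hcancel : ∀ k, b.repr η k * (b.repr v k / b.repr η k) = b.repr v k := fun k =>
    mul_div_cancel_of_imp' fun hk => mem_standardSubspace_iff.1 hv k (not_not.2 hk)
  rw [sum_sum_mul_sub_sq hrow hcol fun k => b.repr v k / b.repr η k, bilin_eq_sum_sum_repr b v v]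
  congr 1
  refine Finset.sum_congr rfl fun i _ => Finset.sum_congr rfl fun j _ => ?_
  nth_rw 1 [← hcancel i, ← hcancel j]
  ring

theorem repr_div_repr_eq_of_bilin_self_eq_zero [Finite ι] (hB : B.IsSymm)
    (hΔ : IsSimpleSystem B (range b)) (hnonneg : 0 ≤ b.repr η) (hrad : ∀ v, B v η = 0)
    (hv : v ∈ standardSubspace b (Function.support (b.repr η))) (hvv : B v v = 0) {i j : ι}
    (hi : i ∈ Function.support (b.repr η)) (hj : j ∈ Function.support (b.repr η))
    (hij : B (b i) (b j) ≠ 0) :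
    b.repr v i / b.repr η i = b.repr v j / b.repr η j := by
  cases nonempty_fintype ι
  have hterm : ∀ i j, b.repr η i * b.repr η j * B (b i) (b j) *
      (b.repr v i / b.repr η i - b.repr v j / b.repr η j) ^ 2 ≤ 0 := fun i j => by
    obtain rfl | hne := eq_or_ne i j
    · rw [sub_self, zero_pow two_ne_zero, mul_zero]
    · exact mul_nonpos_of_nonpos_of_nonneg (mul_nonpos_of_nonneg_of_nonpos
        (mul_nonneg (hnonneg i) (hnonneg j)) (hΔ.bilin_nonpos (mem_range_self i)
          (mem_range_self j) (b.injective.ne hne))) (sq_nonneg _)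
  have hsum := neg_two_mul_bilin_self_eq_sum_sum_sq hB hrad hv
  rw [hvv, mul_zero, eq_comm, Finset.sum_eq_zero_iff_of_nonpos
    fun i _ => Finset.sum_nonpos fun j _ => hterm i j] at hsum
  have hzero := (Finset.sum_eq_zero_iff_of_nonpos fun j _ => hterm i j).1
    (hsum i (Finset.mem_univ i)) j (Finset.mem_univ j)
  exact sub_eq_zero.1 <| pow_eq_zero_iff two_ne_zero |>.1 <|
    (mul_eq_zero.1 hzero).resolve_left (mul_ne_zero (mul_ne_zero hi hj) hij)

variable [Fintype ι]

/-- The vector `η` spans the radical of an irreducible affine standard parabolic subsystem, the one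
formed by the simple roots in its support: its coordinates are nonnegative with sum `1`, it is
`B`-orthogonal to `V`, and its support is not a union of two nonempty `B`-orthogonal parts. -/
structure IsAffineRadical (B : LinearMap.BilinForm ℝ V) (b : Module.Basis ι ℝ V) (η : V) :
    Prop where
  repr_nonneg : 0 ≤ b.repr η
  coordSum_eq_one : coordSum b η = 1
  bilin_eq_zero : ∀ v, B v η = 0
  eq_support_of_orthogonal : ∀ S ⊆ Function.support (b.repr η), S.Nonempty →
    (∀ i ∈ S, ∀ j ∈ Function.support (b.repr η) \ S, B (b i) (b j) = 0) →
      S = Function.support (b.repr η)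

namespace IsAffineRadical

variable (h : IsAffineRadical B b η)
include h

theorem ne_zero : η ≠ 0 := by
  rintro rfl
  have hsum := h.coordSum_eq_one
  rw [← zero_smul ℝ (0 : V), coordSum_smul, zero_mul] at hsum
  exact zero_ne_one hsum

theorem support_nonempty : (Function.support (b.repr η)).Nonempty :=
  Function.support_nonempty_iff.2 <|
    DFunLike.coe_injective.ne_iff' Finsupp.coe_zero |>.2 <| b.repr.map_ne_zero_iff.2 h.ne_zero

theorem weylGroup_apply {Δ : Set V} {w : V ≃ₗ[ℝ] V} (hw : w ∈ weylGroup B Δ) : w η = η := by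
  induction hw using weylGroup_induction with
  | one => rfl
  | reflection_mul α _ hα w _ hwη =>
    rw [LinearEquiv.mul_apply, hwη, reflection_apply, reflectionMap_apply, h.bilin_eq_zero,
      zero_div, mul_zero, zero_smul, sub_zero]

theorem eq_smul_of_bilin_self_eq_zero (hB : B.IsSymm) (hΔ : IsSimpleSystem B (range b))
    (hv : v ∈ standardSubspace b (Function.support (b.repr η))) (hvv : B v v = 0) :
    ∃ c : ℝ, v = c • η := by
  obtain ⟨i₀, hi₀⟩ := h.support_nonempty
  set S : Set ι := {i ∈ Function.support (b.repr η) |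
    b.repr v i / b.repr η i = b.repr v i₀ / b.repr η i₀}
  have hS : S = Function.support (b.repr η) := by
    refine h.eq_support_of_orthogonal S (sep_subset _ _) ⟨i₀, hi₀, rfl⟩
      fun i hi j hj => by_contra fun hij => hj.2 ⟨hj.1, ?_⟩
    rw [← hi.2]
    exact (repr_div_repr_eq_of_bilin_self_eq_zero hB hΔ h.repr_nonneg h.bilin_eq_zero hv hvv
      hi.1 hj.1 hij).symm
  refine ⟨b.repr v i₀ / b.repr η i₀, b.ext_elem fun i => ?_⟩
  rw [map_smul, Finsupp.smul_apply, smul_eq_mul]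
  by_cases hi : i ∈ Function.support (b.repr η)
  · rw [← (hS.symm ▸ hi : i ∈ S).2, div_mul_cancel₀ _ hi]
  · rw [mem_standardSubspace_iff.1 hv i hi, Function.notMem_support.1 hi, mul_zero]

end IsAffineRadical

end Radical

section LimitInRadical

open Filter

variable {V ι : Type*} [NormedAddCommGroup V] [NormedSpace ℝ V] [Fintype ι]
  {B : LinearMap.BilinForm ℝ V} {b : Module.Basis ι ℝ V} {F : Filter V} {η : V}

theorem eventually_repr_ne_zero_of_tendsto (hη : Tendsto (normalize b) F (𝓝 η)) {i : ι}
    (hi : i ∈ Function.support (b.repr η)) : ∀ᶠ ρ in F, b.repr ρ i ≠ 0 := by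
  filter_upwards [(((continuous_coord b i).tendsto η).comp hη).eventually_ne hi] with ρ hρ hρi
  exact hρ (by simp only [Function.comp_apply, normalize, map_smul, Finsupp.smul_apply,
    hρi, smul_zero])

theorem isAffineRadical_of_tendsto [F.NeBot] (hB : B.IsSymm) (hΔ : IsSimpleSystem B (range b))
    (hF : F ≤ posRootsCofinite B b) (hη : Tendsto (normalize b) F (𝓝 η))
    (hrad : ∀ v, B v η = 0) : IsAffineRadical B b η where
  repr_nonneg := repr_nonneg_of_tendsto hF hη
  coordSum_eq_one := coordSum_eq_one_of_tendsto hB hΔ hF hη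
  bilin_eq_zero := hrad
  eq_support_of_orthogonal S hSsub hSne hS := by
    obtain ⟨i, hi⟩ := hSne
    refine hSsub.antisymm fun j hj => by_contra fun hjS => ?_
    have horth : ∀ i ∈ S, ∀ j ∉ S, B (b i) (b j) = 0 := fun i hi j hj => by
      by_cases hjη : j ∈ Function.support (b.repr η)
      · exact hS i hi j ⟨hjη, hj⟩
      · exact bilin_eq_zero_of_mem_support_of_notMem hB hΔ (repr_nonneg_of_tendsto hF hη) hrad
          i (hSsub hi) j hjη
    obtain ⟨ρ, hρ, hρi, hρj⟩ := ((eventually_mem_posRoots hF).and <|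
      (eventually_repr_ne_zero_of_tendsto hη (hSsub hi)).and <|
        eventually_repr_ne_zero_of_tendsto hη hj).exists
    obtain hρS | hρS := root_mem_standardSubspace_or hB horth hρ.1
    · exact hρj (mem_standardSubspace_iff.1 hρS j hjS)
    · exact hρi (mem_standardSubspace_iff.1 hρS i (not_not.2 hi))

end LimitInRadical

section DominantFunctionals

variable {V ι : Type*} [AddCommGroup V] [Module ℝ V] {B : LinearMap.BilinForm ℝ V}
  {b : Module.Basis ι ℝ V} {S : Set ι} {f : Module.Dual ℝ V}

/-- The roots in the span of the simple roots with index in `S`. -/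
def standardRoots (B : LinearMap.BilinForm ℝ V) (b : Module.Basis ι ℝ V) (S : Set ι) : Set V :=
  roots B (range b) ∩ standardSubspace b S

/-- The positive roots in the span of the simple roots with index in `S` on which the functional
`f` is negative. Their number measures how far `f` is from being dominant, that is, nonnegative
on these simple roots. -/
def negativeRoots (B : LinearMap.BilinForm ℝ V) (b : Module.Basis ι ℝ V) (S : Set ι)
    (f : Module.Dual ℝ V) : Set V :=
  {ρ | ρ ∈ posRoots B (range b) ∧ ρ ∈ standardSubspace b S ∧ f ρ < 0}

theorem apply_mem_standardRoots (hB : B.IsSymm) (hS : ∀ i ∈ S, ∀ j ∉ S, B (b i) (b j) = 0)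
    {w : V ≃ₗ[ℝ] V} (hw : w ∈ weylGroup B (range b)) {ρ : V} (hρ : ρ ∈ standardRoots B b S) :
    w ρ ∈ standardRoots B b S :=
  ⟨apply_mem_roots hw hρ.1, apply_mem_standardSubspace hB hS hw hρ.2⟩

theorem negativeRoots_comp_reflection_subset (hB : B.IsSymm) (hΔ : IsSimpleSystem B (range b))
    (hS : ∀ i ∈ S, ∀ j ∉ S, B (b i) (b j) = 0) {i : ι} (hi : B (b i) (b i) ≠ 0)
    (hfi : f (b i) < 0) :
    negativeRoots B b S (f ∘ₗ reflection B (b i) hi) ⊆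
      reflection B (b i) hi '' (negativeRoots B b S f \ {b i}) := by
  have hself := reflectionMap_self (hΔ.diag _ (mem_range_self i))
  rintro ρ ⟨hρ, hρS, hfρ⟩
  have hρi : ρ ≠ b i := by
    rintro rfl
    rw [LinearMap.comp_apply, LinearEquiv.coe_coe, reflection_apply, hself, map_neg] at hfρ
    linarith
  have hpos := reflectionMap_mem_posRoots hB hΔ hρ hρi
  refine ⟨reflection B (b i) hi ρ, ⟨⟨hpos, apply_mem_standardSubspace hB hS
    (reflection_mem_weylGroup (mem_range_self i) hi) hρS, hfρ⟩, fun heq => ?_⟩,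
    reflectionMap_involutive B (b i) hi ρ⟩
  have hρ_neg : ρ = -b i := by
    rw [← reflectionMap_involutive B (b i) hi ρ, ← hself]
    exact congrArg _ heq
  have hnonneg := (mem_posRoots_iff.1 hρ).2 i
  rw [hρ_neg, map_neg, Finsupp.neg_apply, b.repr_self, Finsupp.single_eq_same,
    Finsupp.zero_apply] at hnonneg
  linarith

theorem exists_weylGroup_dominant (hB : B.IsSymm) (hΔ : IsSimpleSystem B (range b))
    (hS : ∀ i ∈ S, ∀ j ∉ S, B (b i) (b j) = 0) (hfin : (negativeRoots B b S f).Finite) :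
    ∃ w ∈ weylGroup B (range b), ∀ i ∈ S, 0 ≤ f (w (b i)) := by
  induction hn : (negativeRoots B b S f).ncard using Nat.strong_induction_on generalizing f with
  | _ n ih =>
  subst hn
  by_cases! hdom : ∀ i ∈ S, 0 ≤ f (b i)
  · exact ⟨1, one_mem _, hdom⟩
  obtain ⟨i, hiS, hfi⟩ := hdom
  have hi : B (b i) (b i) ≠ 0 := (hΔ.diag _ (mem_range_self i)).trans_ne one_ne_zero
  have hsub := negativeRoots_comp_reflection_subset hB hΔ hS hi hfi
  have hi_mem : b i ∈ negativeRoots B b S f :=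
    ⟨mem_posRoots_iff.2 ⟨subset_roots (mem_range_self i), by
      rw [b.repr_self]; exact Finsupp.single_nonneg.2 zero_le_one⟩,
      basis_mem_standardSubspace hiS, hfi⟩
  have hdiff : (negativeRoots B b S f \ {b i}).Finite := hfin.subset sdiff_subset
  obtain ⟨w, hw, hdom⟩ := ih _
    (calc _ ≤ _ := ncard_le_ncard hsub (hdiff.image _)
      _ ≤ (negativeRoots B b S f \ {b i}).ncard := ncard_image_le hdiff
      _ < _ := ncard_sdiff_singleton_lt_of_mem hi_mem hfin)
    ((hdiff.image _).subset hsub) rfl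
  exact ⟨reflection B (b i) hi * w,
    mul_mem (reflection_mem_weylGroup (mem_range_self i) hi) hw, hdom⟩

variable [Finite ι]

theorem repr_eq_zero_of_apply_eq_zero (hf : ∀ k ∈ S, 0 ≤ f (b k)) {v : V}
    (hv : v ∈ standardSubspace b S) (hnonneg : 0 ≤ b.repr v) (hfv : f v = 0) {i : ι}
    (hi : 0 < f (b i)) : b.repr v i = 0 := by
  cases nonempty_fintype ι
  have hterm : ∀ k ∈ Finset.univ, 0 ≤ b.repr v k * f (b k) := fun k _ => by
    by_cases hk : k ∈ S
    · exact mul_nonneg (hnonneg k) (hf k hk)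
    · rw [mem_standardSubspace_iff.1 hv k hk, zero_mul]
  rw [dual_apply_eq_sum_repr b, Finset.sum_eq_zero_iff_of_nonneg hterm] at hfv
  exact (mul_eq_zero.1 (hfv i (Finset.mem_univ i))).resolve_right hi.ne'

theorem repr_root_eq_zero_of_apply_eq_zero (hB : B.IsSymm) (hΔ : IsSimpleSystem B (range b))
    (hf : ∀ k ∈ S, 0 ≤ f (b k)) {ρ : V} (hρ : ρ ∈ standardRoots B b S) (hfρ : f ρ = 0) {i : ι}
    (hi : 0 < f (b i)) : b.repr ρ i = 0 := by
  obtain hnonneg | hnonpos := repr_nonneg_or_nonpos hB hΔ hρ.1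
  · exact repr_eq_zero_of_apply_eq_zero hf hρ.2 hnonneg hfρ hi
  · rw [← neg_eq_zero, ← Finsupp.neg_apply, ← map_neg]
    refine repr_eq_zero_of_apply_eq_zero hf (neg_mem hρ.2) ?_ (by rw [map_neg, hfρ, neg_zero]) hi
    rwa [map_neg, neg_nonneg]

end DominantFunctionals

section AffineComponent

open Filter

variable {V ι : Type*} [NormedAddCommGroup V] [NormedSpace ℝ V] [Fintype ι]
  {B : LinearMap.BilinForm ℝ V} {b : Module.Basis ι ℝ V} {η : V}

namespace IsAffineRadical

variable (h : IsAffineRadical B b η) (hB : B.IsSymm) (hΔ : IsSimpleSystem B (range b))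
include h hB hΔ

theorem finite_standardRoots_repr_eq_zero {i : ι} (hi : i ∈ Function.support (b.repr η)) :
    {ρ ∈ standardRoots B b (Function.support (b.repr η)) | b.repr ρ i = 0}.Finite := by
  refine (finite_roots_inter_of_anisotropic hB hΔ (U := standardSubspace b
    (Function.support (b.repr η)) ⊓ (b.coord i).ker) fun v hv hvv => ?_).subset
    fun ρ hρ => ⟨hρ.1.1, hρ.1.2, hρ.2⟩
  obtain ⟨c, rfl⟩ := h.eq_smul_of_bilin_self_eq_zero hB hΔ hv.1 hvv
  have hci : c * b.repr η i = 0 := by simpa using hv.2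
  rw [(mul_eq_zero.1 hci).resolve_right hi, zero_smul]

theorem finite_negativeRoots {f : Module.Dual ℝ V} (hf : 0 < f η) :
    (negativeRoots B b (Function.support (b.repr η)) f).Finite := by
  have : FiniteDimensional ℝ V := b.finiteDimensional_of_finite
  set U := standardSubspace b (Function.support (b.repr η))
  by_contra hinf
  have hclosed : IsClosed ((U : Set V) ∩ {v | f v ≤ 0}) :=
    U.closed_of_finiteDimensional.inter
      (isClosed_le f.continuous_of_finiteDimensional continuous_const)
  obtain ⟨ζ, ⟨hζU, hfζ⟩, hζζ, hζ⟩ := exists_isotropic_of_infinite hB hΔ hinf (fun ρ hρ => hρ.1)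
    hclosed fun ρ hρ => ⟨U.smul_mem _ hρ.2.1, by
      rw [mem_ofPred_eq, normalize, map_smul]
      exact mul_nonpos_of_nonneg_of_nonpos
        (inv_nonneg.2 (coordSum_posRoot_pos hB hΔ hρ.1).le) hρ.2.2.le⟩
  obtain ⟨c, rfl⟩ := h.eq_smul_of_bilin_self_eq_zero hB hΔ hζU hζζ
  rw [coordSum_smul, h.coordSum_eq_one, mul_one] at hζ
  rw [hζ, one_smul] at hfζ
  exact hfζ.not_gt hf

theorem bilin_eq_zero_of_mem_of_notMem : ∀ i ∈ Function.support (b.repr η),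
    ∀ j ∉ Function.support (b.repr η), B (b i) (b j) = 0 :=
  bilin_eq_zero_of_mem_support_of_notMem hB hΔ h.repr_nonneg h.bilin_eq_zero

theorem exists_weylGroup_repr_eq_zero {f : Module.Dual ℝ V} (hf : 0 < f η) :
    ∃ w ∈ weylGroup B (range b), ∃ i ∈ Function.support (b.repr η),
      ∀ ρ ∈ standardRoots B b (Function.support (b.repr η)), f ρ = 0 → b.repr (w ρ) i = 0 := by
  have horth := h.bilin_eq_zero_of_mem_of_notMem hB hΔ
  obtain ⟨w, hw, hdom⟩ := exists_weylGroup_dominant hB hΔ horth (h.finite_negativeRoots hB hΔ hf)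
  obtain ⟨i, hi, hpos⟩ : ∃ i ∈ Function.support (b.repr η), 0 < f (w (b i)) := by
    by_contra! hnonpos
    refine hf.not_ge ?_
    rw [← h.weylGroup_apply hw, ← LinearEquiv.coe_coe, ← LinearMap.comp_apply,
      dual_apply_eq_sum_repr b]
    refine Finset.sum_nonpos fun k _ => ?_
    by_cases hk : k ∈ Function.support (b.repr η)
    · exact mul_nonpos_of_nonneg_of_nonpos (h.repr_nonneg k) (hnonpos k hk)
    · rw [Function.notMem_support.1 hk, zero_mul]
  refine ⟨w⁻¹, inv_mem hw, i, hi, fun ρ hρ hfρ => ?_⟩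
  refine repr_root_eq_zero_of_apply_eq_zero hB hΔ (f := f ∘ₗ w.toLinearMap) hdom
    (apply_mem_standardRoots hB horth (inv_mem hw) hρ) ?_ hpos
  rwa [LinearMap.comp_apply, LinearEquiv.coe_coe, LinearEquiv.coe_inv, w.apply_symm_apply]

theorem finite_image2_bilin_standardRoots :
    (image2 (fun ρ σ => B ρ σ) (standardRoots B b (Function.support (b.repr η)))
      (standardRoots B b (Function.support (b.repr η)))).Finite := by
  have horth := h.bilin_eq_zero_of_mem_of_notMem hB hΔ
  set R := standardRoots B b (Function.support (b.repr η))
  have hfin : ({1, -1} ∪ ⋃ i ∈ Function.support (b.repr η),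
      image2 (fun ρ σ => B ρ σ) {ρ ∈ R | b.repr ρ i = 0} {ρ ∈ R | b.repr ρ i = 0}).Finite :=
    (toFinite _).union ((toFinite _).biUnion fun i hi =>
      (h.finite_standardRoots_repr_eq_zero hB hΔ hi).image2 _
        (h.finite_standardRoots_repr_eq_zero hB hΔ hi))
  refine hfin.subset (image2_subset_iff.2 fun ρ hρ σ hσ => ?_)
  by_cases hspan : η ∈ Submodule.span ℝ {ρ, σ}
  · exact .inl (bilin_eq_one_or_eq_neg_one_of_mem_span hB (bilin_root_self hB hΔ.diag hρ.1)
      (bilin_root_self hB hΔ.diag hσ.1) h.ne_zero h.bilin_eq_zero hspan)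
  · obtain ⟨g, hgη, hg⟩ := Submodule.exists_le_ker_of_notMem hspan
    obtain ⟨w, hw, i, hi, hrepr⟩ := h.exists_weylGroup_repr_eq_zero hB hΔ (f := g η • g)
      (mul_self_pos.2 hgη)
    have hker : ∀ τ ∈ ({ρ, σ} : Set V), (g η • g) τ = 0 := fun τ hτ => by
      rw [LinearMap.smul_apply, LinearMap.mem_ker.1 (hg (Submodule.subset_span hτ)), smul_zero]
    refine .inr (mem_biUnion hi
      ⟨w ρ, ⟨apply_mem_standardRoots hB horth hw hρ, hrepr ρ hρ (hker ρ (.inl rfl))⟩,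
        w σ, ⟨apply_mem_standardRoots hB horth hw hσ, hrepr σ hσ (hker σ (.inr rfl))⟩,
        bilin_weylGroup_apply hB hw ρ σ⟩)

end IsAffineRadical

end AffineComponent

section RadicalLimits

open Filter

variable {V ι : Type*} [NormedAddCommGroup V] [NormedSpace ℝ V] [Fintype ι]
  {B : LinearMap.BilinForm ℝ V} {b : Module.Basis ι ℝ V} {η : V}

namespace IsAffineRadical

theorem exists_ne_zero_sub_eq_smul (h : IsAffineRadical B b η) (hB : B.IsSymm)
    (hΔ : IsSimpleSystem B (range b))
    (hinf : (standardRoots B b (Function.support (b.repr η))).Infinite) :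
    ∃ ρ ∈ roots B (range b), ∃ σ ∈ roots B (range b), ∃ c ≠ (0 : ℝ), ρ - σ = c • η := by
  set R := standardRoots B b (Function.support (b.repr η))
  have hbasis : ∀ i ∈ Function.support (b.repr η), b i ∈ R := fun i hi =>
    ⟨subset_roots (mem_range_self i), basis_mem_standardSubspace hi⟩
  have hmaps : MapsTo (fun ρ (i : Function.support (b.repr η)) => B (b i) ρ) R
      (Set.pi univ fun _ => image2 (fun ρ σ => B ρ σ) R R) := fun ρ hρ i _ =>
    mem_image2_of_mem (hbasis i i.2) hρ
  obtain ⟨ρ, hρ, σ, hσ, hne, hprod⟩ := hinf.exists_ne_map_eq_of_mapsTo hmaps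
    (Finite.pi fun _ => h.finite_image2_bilin_standardRoots hB hΔ)
  have hsub : ρ - σ ∈ standardSubspace b (Function.support (b.repr η)) := sub_mem hρ.2 hσ.2
  have hisotropic : B (ρ - σ) (ρ - σ) = 0 :=
    bilin_eq_zero_of_mem_standardSubspace (fun i hi => hB.isRefl.eq_zero <| by
      rw [map_sub, sub_eq_zero]; exact congrFun hprod ⟨i, hi⟩) hsub
  obtain ⟨c, hc⟩ := h.eq_smul_of_bilin_self_eq_zero hB hΔ hsub hisotropic
  refine ⟨ρ, hρ.1, σ, hσ.1, c, fun hc0 => hne ?_, hc⟩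
  rwa [hc0, zero_smul, sub_eq_zero] at hc

theorem exists_basis_sub_smul_mem_roots (h : IsAffineRadical B b η) (hB : B.IsSymm)
    (hΔ : IsSimpleSystem B (range b))
    (hinf : (standardRoots B b (Function.support (b.repr η))).Infinite) :
    ∃ j, ∃ c ≠ (0 : ℝ), b j - c • η ∈ roots B (range b) := by
  obtain ⟨_, ⟨w, hw, _, ⟨j, rfl⟩, rfl⟩, σ, hσ, c, hc, heq⟩ :=
    h.exists_ne_zero_sub_eq_smul hB hΔ hinf
  refine ⟨j, c, hc, ?_⟩
  have hσw : b j - c • η = w⁻¹ σ := by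
    rw [← sub_sub_cancel (w (b j)) σ, heq, map_sub, map_smul, h.weylGroup_apply (inv_mem hw),
      LinearEquiv.coe_inv, w.symm_apply_apply]
  exact hσw ▸ apply_mem_roots (inv_mem hw) hσ

end IsAffineRadical

theorem mem_affineSpan_basis_normalize_sub_smul (hη : coordSum b η = 1) {j : ι} {c : ℝ}
    (hc : c ≠ 0) (hsum : coordSum b (b j - c • η) ≠ 0) :
    η ∈ affineSpan ℝ {b j, normalize b (b j - c • η)} := by
  have hcoord : coordSum b (b j - c • η) = 1 - c := by
    rw [sub_eq_add_neg, ← neg_smul, coordSum_add, coordSum_smul, coordSum_basis, hη, mul_one,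
      sub_eq_add_neg]
  rw [hcoord] at hsum
  -- `η = c⁻¹ • b j + (1 - c⁻¹) • normalize b (b j - c • η)`
  refine mem_affineSpan_pair_iff_exists_lineMap_eq.2 ⟨1 - c⁻¹, ?_⟩
  have hweight : (1 - c⁻¹) * (1 - c)⁻¹ = -c⁻¹ := by field_simp; ring
  rw [AffineMap.lineMap_apply_module, normalize, hcoord, smul_smul, hweight, smul_sub, smul_smul,
    neg_mul, inv_mul_cancel₀ hc]
  module

theorem mem_simpleDihedralLimitRoots_of_basis_sub_smul (hB : B.IsSymm)
    (hΔ : IsSimpleSystem B (range b)) (hηη : B η η = 0) (hη : coordSum b η = 1) {j : ι} {c : ℝ}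
    (hc : c ≠ 0) (hroot : b j - c • η ∈ roots B (range b)) :
    η ∈ simpleDihedralLimitRoots B b := by
  obtain ⟨τ, hτ, hnorm⟩ : ∃ τ ∈ posRoots B (range b),
      normalize b τ = normalize b (b j - c • η) := by
    obtain hpos | hneg := mem_posRoots_or_neg_mem_posRoots hB hΔ hroot
    · exact ⟨_, hpos, rfl⟩
    · exact ⟨_, hneg, normalize_neg _⟩
  refine mem_biUnion (mem_range_self j) (mem_biUnion hτ ⟨?_, hηη, hη⟩)
  rw [hnorm]
  exact mem_affineSpan_basis_normalize_sub_smul hη hc (coordSum_root_ne_zero hB hΔ hroot)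

variable {F : Filter V} [F.NeBot]

theorem infinite_standardRoots_of_tendsto (hB : B.IsSymm) (hΔ : IsSimpleSystem B (range b))
    (hF : F ≤ posRootsCofinite B b) (hη : Tendsto (normalize b) F (𝓝 η))
    (h : IsAffineRadical B b η) :
    (standardRoots B b (Function.support (b.repr η))).Infinite := by
  intro hfin
  obtain ⟨i, hi⟩ := h.support_nonempty
  have hnotMem : ∀ᶠ ρ in F, ρ ∉ standardRoots B b (Function.support (b.repr η)) :=
    hF (mem_inf_of_left hfin.compl_mem_cofinite)
  obtain ⟨ρ, hρ, hρi, hρη⟩ := ((eventually_mem_posRoots hF).and <|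
    (eventually_repr_ne_zero_of_tendsto hη hi).and hnotMem).exists
  obtain hsupp | hcompl := root_mem_standardSubspace_or hB
    (h.bilin_eq_zero_of_mem_of_notMem hB hΔ) hρ.1
  · exact hρη ⟨hρ.1, hsupp⟩
  · exact hρi (mem_standardSubspace_iff.1 hcompl i (not_not.2 hi))

theorem mem_simpleDihedralLimitRoots_of_radical (hB : B.IsSymm) (hΔ : IsSimpleSystem B (range b))
    (hF : F ≤ posRootsCofinite B b) (hη : Tendsto (normalize b) F (𝓝 η))
    (hrad : ∀ v, B v η = 0) : η ∈ simpleDihedralLimitRoots B b := by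
  have h : IsAffineRadical B b η := isAffineRadical_of_tendsto hB hΔ hF hη hrad
  obtain ⟨j, c, hc, hroot⟩ := h.exists_basis_sub_smul_mem_roots hB hΔ
    (infinite_standardRoots_of_tendsto hB hΔ hF hη h)
  exact mem_simpleDihedralLimitRoots_of_basis_sub_smul hB hΔ (hrad η) h.coordSum_eq_one hc hroot

theorem limitRoots_subset_closure (hB : B.IsSymm) (hΔ : IsSimpleSystem B (range b)) :
    limitRoots B b ⊆ closure (simpleDihedralLimitRoots B b) := by
  intro η hη
  obtain ⟨F, _, hF, hlim⟩ := exists_tendsto_normalize_of_mem_limitRoots hB hΔ hη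
  by_cases! hrad : ∀ i, B (b i) η = 0
  · exact subset_closure (mem_simpleDihedralLimitRoots_of_radical hB hΔ hF hlim fun v =>
      hB.isRefl.eq_zero (bilin_eq_zero_of_forall_basis (fun i => hB.isRefl.eq_zero (hrad i)) v))
  · obtain ⟨i, hi⟩ := hrad
    exact mem_closure_simpleDihedralLimitRoots_of_bilin_ne_zero hB hΔ hF hlim hi

end RadicalLimits

end BasedRoot

theorem mainTheorem2 {V : Type*} [NormedAddCommGroup V] [NormedSpace ℝ V]
    {ι : Type*} [Fintype ι] (b : Module.Basis ι ℝ V)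
    (B : LinearMap.BilinForm ℝ V) (hB : B.IsSymm)
    (hΔ : BasedRoot.IsSimpleSystem B (Set.range b))
    (hinf : (BasedRoot.roots B (Set.range b)).Infinite) :
    BasedRoot.simpleDihedralLimitRoots B b ⊆ BasedRoot.limitRoots B b ∧
      BasedRoot.limitRoots B b ⊆ closure (BasedRoot.simpleDihedralLimitRoots B b) :=
  ⟨BasedRoot.simpleDihedralLimitRoots_subset hB hΔ, BasedRoot.limitRoots_subset_closure hB hΔ⟩
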